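/- Let $d\ge 1$, let $u:\mathbb R^d\to\mathbb R$ be differentiable, $h=\nabla u$, and suppose there are $m,L,l>0$ such that for all $x,y\in\mathbb R^d$ $$\langle h(x)-h(y),x-y\rangle\ge 2m|x-y|^2,\qquad |h(x)-h(y)|\le L(1+|x|+|y|)^l|x-y|.$$ For $\lambda>0$ put $g(x)=h(x)-mx$, $r=(L+m)\,(1/\sqrt\lambda)^{1/(l+2)}$, $R=\sup_{|x|<r}|g(x)|$, and define the tamed drift $$h_\lambda(x)=t(x)g(x)+R\,s(x)\,x+mx,$$ where $t(x)=1$ if $|x|\le r-1$, $t(x)=r-|x|$ if $r-1<|x|<r$, $t(x)=0$ if $|x|\ge r$; and $s(x)=0$ if $|x|\le r-2$, $s(x)=|x|-r+2$ if $r-2<|x|<r-1$, $s(x)=1$ if $r-1\le|x|\le r$ (in the cases not covered before), $s(x)=r/|x|$ if $|x|>r$. Let $\gamma>0$ and $\eta=e^{-\lambda\gamma/2}$. Let $P$ be the OBABO Markov kernel on $\mathbb R^{2d}$: $P((x_0,v_0),\cdot)$ is the law of $(x_1,v_1)$, where $$x_1=x_0+\lambda\big(\eta v_0+\sqrt{1-\eta^2}\,G\big)-\tfrac{\lambda^2}{2}h_\lambda(x_0),\qquad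 v_1=\eta^2v_0-\tfrac{\lambda\eta}{2}\big(h_\lambda(x_0)+h_\lambda(x_1)\big)+\sqrt{1-\eta^2}\,(\eta G+G')$$ with $G,G'$ independent standard Gaussian vectors in $\mathbb R^d$. Let $M_\lambda$ be the (smallest) Lipschitz constant of $h_\lambda$, or any larger real number. Assume $\gamma\ge 2\sqrt{M_\lambda}$ and $\lambda\le m/(33\gamma^3)$, and set $a=1/M_\lambda$, $b=1/\gamma$, $\kappa=m/(3\gamma)$. For $p\ge1$, $\mathcal P_p(\mathbb R^{2d})$ is the set of Borel probability measures with finite $p$-th moment, $\mathcal W_p$ is the $p$-Wasserstein distance for the Euclidean norm of $\mathbb R^{2d}$, and $\mathcal W_{p,a,b}$ is the one for the norm $|(x,v)|_{a,b}=(|x|^2+2b\langle x,v\rangle+a|v|^2)^{1/2}$. Then for all $p\ge 1$ and all $\nu,\mu\in\mathcal P_p(\mathbb R^{2d})$, $$\mathcal W_{p,a,b}^2(\nu P,\mu P)\le(1-\lambda\kappa)\,\mathcal W_{p,a,b}^2(\nu,\mu),$$ and, if $M_\lambda\ge1$, for all $n\in\mathbb N$, $$\mathcal W_p^2(\nu P^n,\mu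 P^n)\le 3M_\lambda(1-\lambda\kappa)^n\,\mathcal W_p^2(\nu,\mu).$$ Moreover, $P$ has an invariant probability measure $\Pi_\lambda$; it is the only one among all probability measures on $\mathbb R^{2d}$, and $\Pi_\lambda\in\mathcal P_p(\mathbb R^{2d})$ for all $p\ge1$. -/

import Mathlib

open MeasureTheory ProbabilityTheory
open scoped ENNReal NNReal

noncomputable section

namespace TamedOBABO

/-- The position (and velocity) space `ℝᵈ` with its Euclidean norm. -/
abbrev E (d : ℕ) : Type := EuclideanSpace ℝ (Fin d)

/-- The phase space `ℝ²ᵈ`, written as pairs `z = (x, v)`. The default norm of a product type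
(the maximum) is never used: all norms on it are given explicitly by `weightedNorm`. -/
abbrev Phase (d : ℕ) : Type := E d × E d

/-- Strong convexity: `⟨h x - h y, x - y⟩ ≥ 2 m |x - y|²`. -/
def StrongMonotone {d : ℕ} (h : E d → E d) (m : ℝ) : Prop :=
  ∀ x y : E d, 2 * m * ‖x - y‖ ^ 2 ≤ inner ℝ (h x - h y) (x - y)

/-- Local Lipschitz continuity with polynomial growth:
`|h x - h y| ≤ L (1 + |x| + |y|)ˡ |x - y|`. -/
def PolyLipschitz {d : ℕ} (h : E d → E d) (L l : ℝ) : Prop :=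
  ∀ x y : E d, ‖h x - h y‖ ≤ L * (1 + ‖x‖ + ‖y‖) ^ l * ‖x - y‖

section Taming

variable {d : ℕ}

/-- `g(x) = h(x) - m x`. -/
def gDrift (h : E d → E d) (m : ℝ) (x : E d) : E d := h x - m • x

/-- The taming radius `r = (L + m) (1 / √lam) ^ (1 / (l + 2))`. -/
def tamingRadius (m L l lam : ℝ) : ℝ := (L + m) * (1 / √lam) ^ (1 / (l + 2))

/-- `R = sup_{B(0,r)} |g|`. -/
def tamingSup (h : E d → E d) (m r : ℝ) : ℝ :=
  sSup ((fun x : E d => ‖gDrift h m x‖) '' Metric.ball 0 r)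

/-- The cut-off `t`, as a function of `ρ = |x|`. -/
def cutT (r ρ : ℝ) : ℝ :=
  if ρ ≤ r - 1 then 1 else if ρ < r then r - ρ else 0

/-- The cut-off `s`, as a function of `ρ = |x|`. -/
def cutS (r ρ : ℝ) : ℝ :=
  if ρ ≤ r - 2 then 0 else if ρ < r - 1 then ρ - r + 2 else if ρ ≤ r then 1 else r / ρ

/-- The tamed drift `h_lam(x) = t(x) g(x) + R s(x) x + m x`. -/
def tamedDrift (h : E d → E d) (m L l lam : ℝ) (x : E d) : E d :=
  let r := tamingRadius m L l lam
  cutT r ‖x‖ • gDrift h m x + (tamingSup h m r * cutS r ‖x‖) • x + m • x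

/-- The Lipschitz constant of a map, i.e. its smallest one. -/
def lipConst (f : E d → E d) : ℝ≥0 := sInf {K : ℝ≥0 | LipschitzWith K f}

end Taming

section Scheme

variable {d : ℕ}

/-- The damping factor `η = exp (- lam γ / 2)` of each half O-step. -/
def eta (lam γ : ℝ) : ℝ := Real.exp (-(lam * γ) / 2)

/-- The new position of one OBABO step with drift `b` from `(x, v)`, with Gaussian input `G`. -/
def obaboPos (b : E d → E d) (lam γ : ℝ) (x v G : E d) : E d :=
  x + lam • (eta lam γ • v + √(1 - eta lam γ ^ 2) • G) - (lam ^ 2 / 2) • b x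

/-- One OBABO step with drift `b` from `(x, v)`, with Gaussian inputs `G`, `G'`;
the argument is `((x, v), (G, G'))`. -/
def obaboStep (b : E d → E d) (lam γ : ℝ) (w : Phase d × (E d × E d)) : Phase d :=
  let x := w.1.1
  let v := w.1.2
  let G := w.2.1
  let G' := w.2.2
  let x₁ := obaboPos b lam γ x v G
  (x₁, eta lam γ ^ 2 • v - (lam * eta lam γ / 2) • (b x + b x₁)
        + √(1 - eta lam γ ^ 2) • (eta lam γ • G + G'))

/-- The OBABO step written as the five substeps O, B, A, B, O. -/
theorem obaboStep_eq_substeps (b : E d → E d) (lam γ : ℝ) (x v G G' : E d) :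
    obaboStep b lam γ ((x, v), (G, G')) =
      (let v₀ := eta lam γ • v + √(1 - eta lam γ ^ 2) • G
       let vh := v₀ - (lam / 2) • b x
       let x₁ := x + lam • vh
       let v' := vh - (lam / 2) • b x₁
       (x₁, eta lam γ • v' + √(1 - eta lam γ ^ 2) • G')) := by
  have hx : obaboPos b lam γ x v G =
      x + lam • (eta lam γ • v + √(1 - eta lam γ ^ 2) • G - (lam / 2) • b x) := by
    unfold obaboPos
    module
  simp only [obaboStep, hx]
  refine Prod.ext rfl ?_
  simp only
  module

/-- The Markov kernel `P` of the OBABO chain: `P(z, ·)` is the law of the step from `z` with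
independent standard Gaussian inputs (see `obaboKernel_apply`). -/
def obaboKernel (b : E d → E d) (lam γ : ℝ) : Kernel (Phase d) (Phase d) :=
  (Kernel.id ×ₖ Kernel.const (Phase d) ((stdGaussian (E d)).prod (stdGaussian (E d)))).map
    (obaboStep b lam γ)

theorem measurable_obaboStep {b : E d → E d} (hb : Measurable b) (lam γ : ℝ) :
    Measurable (obaboStep b lam γ) := by
  unfold obaboStep obaboPos
  fun_prop

theorem obaboKernel_apply {b : E d → E d} (hb : Measurable b) (lam γ : ℝ) (z : Phase d) :
    obaboKernel b lam γ z =
      ((stdGaussian (E d)).prod (stdGaussian (E d))).map (fun G => obaboStep b lam γ (z, G)) := by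
  have hs := measurable_obaboStep hb lam γ
  rw [obaboKernel, Kernel.map_apply _ hs, Kernel.prod_apply, Kernel.id_apply, Kernel.const_apply,
    Measure.dirac_prod, Measure.map_map hs (by fun_prop)]
  rfl

/-- The law `ν Pⁿ`. -/
def lawAfter (P : Kernel (Phase d) (Phase d)) (n : ℕ) (ν : Measure (Phase d)) :
    Measure (Phase d) :=
  (fun ρ : Measure (Phase d) => ρ.bind P)^[n] ν

end Scheme

section Wasserstein

variable {d : ℕ}

/-- The weighted norm `|z|_{a,b} = (|x|² + 2 b ⟨x, v⟩ + a |v|²)^{1/2}` of `z = (x, v)`. -/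
def weightedNorm (a b : ℝ) (z : Phase d) : ℝ :=
  √(‖z.1‖ ^ 2 + 2 * b * inner ℝ z.1 z.2 + a * ‖z.2‖ ^ 2)

/-- The Euclidean norm of `ℝ²ᵈ`. -/
def euclNorm (z : Phase d) : ℝ := √(‖z.1‖ ^ 2 + ‖z.2‖ ^ 2)

/-- The set `𝒫_p(ℝ²ᵈ)` of probability measures with finite `p`-th moment. -/
def InPp (p : ℝ) (μ : Measure (Phase d)) : Prop :=
  IsProbabilityMeasure μ ∧ ∫⁻ z, ENNReal.ofReal (euclNorm z) ^ p ∂μ < ⊤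

/-- The couplings of `μ` and `ν`. -/
def couplings (μ ν : Measure (Phase d)) : Set (Measure (Phase d × Phase d)) :=
  {ρ | ρ.map Prod.fst = μ ∧ ρ.map Prod.snd = ν}

/-- The `p`-Wasserstein distance for the norm `N`:
`(inf_ρ ∫ N(z - z')ᵖ dρ(z, z'))^{1/p}` over the couplings `ρ` of `μ` and `ν`. -/
def wass (N : Phase d → ℝ) (p : ℝ) (μ ν : Measure (Phase d)) : ℝ≥0∞ :=
  (⨅ ρ ∈ couplings μ ν, ∫⁻ w, ENNReal.ofReal (N (w.1 - w.2)) ^ p ∂ρ) ^ (1 / p)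

end Wasserstein

end TamedOBABO

end

open TamedOBABO

/-!
Run two copies of the chain with the same Gaussian inputs. In the variables `(x, v / γ)` the
friction is `1`, and a quadratic form computation shows that one step contracts the square of the
norm `|·|_{a,b}` of the difference as soon as the increments `w` of `h_lam - m` satisfy
`|w|² ≤ 3 (M - m) ⟨w, x - y⟩`.

This cocoercivity does not come for free, because the tamed drift is not a gradient. For `|x| ≤ |y|`
the increment of `h_lam - m` splits into `t(y) (g(x) - g(y))`, to which the Baillon–Haddad argument
for the convex potential `u - m |·|² / 2` applies on balls, and a radial part, which is controlled
because a step of length `δ` outwards decreases `t` by at most `δ` while `ρ s(ρ)` increases enough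
to absorb the lost part of `g`, whose norm is at most `R`.

Taking infima over couplings gives the Wasserstein bounds. For the invariant law, the backward
iterates `F_{ω 0} ∘ ⋯ ∘ F_{ω (n - 1)} (z)` of the random maps form an almost surely Cauchy sequence,
dominated in `L^p` by a geometric series, with a limit independent of `z`: its law is invariant, has
all moments, and equals every invariant probability law.
-/

open Filter
open scoped Topology

namespace TamedOBABO

section Cutoff

variable {r ρ σ : ℝ}

theorem cutT_eq_max_min (r ρ : ℝ) : cutT r ρ = max 0 (min 1 (r - ρ)) := by
  unfold cutT
  grind

theorem cutT_nonneg : 0 ≤ cutT r ρ :=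
  cutT_eq_max_min r ρ ▸ le_max_left _ _

theorem cutT_le_one : cutT r ρ ≤ 1 :=
  cutT_eq_max_min r ρ ▸ max_le zero_le_one (min_le_left _ _)

theorem cutT_of_le (h : ρ ≤ r - 1) : cutT r ρ = 1 :=
  if_pos h

theorem cutT_of_ge (h : r ≤ ρ) : cutT r ρ = 0 := by
  rw [cutT_eq_max_min]
  grind

theorem cutT_antitone (r : ℝ) : Antitone (cutT r) := fun ρ σ h ↦ by
  simp only [cutT_eq_max_min]
  gcongr

theorem continuous_cutT (r : ℝ) : Continuous (cutT r) := by
  simp only [funext (cutT_eq_max_min r)]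
  fun_prop

theorem cutT_sub_le (h : ρ ≤ σ) : cutT r ρ - cutT r σ ≤ σ - ρ := by
  simp only [cutT_eq_max_min]
  grind

theorem cutS_eq_max_min (h : ρ ≤ r) : cutS r ρ = max 0 (min 1 (ρ - r + 2)) := by
  unfold cutS
  grind

theorem cutS_of_shell (h₁ : r - 1 ≤ ρ) (h₂ : ρ ≤ r) : cutS r ρ = 1 := by
  rw [cutS_eq_max_min h₂]
  grind

theorem cutS_mul_of_ge (hr : 0 < r) (h : r ≤ ρ) : cutS r ρ * ρ = r := by
  rcases h.eq_or_lt with rfl | h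
  · rw [cutS_of_shell (by linarith) le_rfl, one_mul]
  · rw [cutS, if_neg (by linarith), if_neg (by linarith), if_neg (by linarith),
      div_mul_cancel₀ _ (hr.trans h).ne']

theorem cutS_mem_Icc (hr : 0 < r) : cutS r ρ ∈ Set.Icc 0 1 := by
  rcases le_or_gt ρ r with h | h
  · rw [cutS_eq_max_min h]
    exact ⟨le_max_left _ _, max_le zero_le_one (min_le_left _ _)⟩
  · have hρ : 0 < ρ := hr.trans h
    rw [eq_div_of_mul_eq hρ.ne' (cutS_mul_of_ge hr h.le)]
    exact ⟨by positivity, (div_le_one hρ).2 h.le⟩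

theorem cutT_add_cutS_mul_of_le (h : ρ ≤ r - 1) :
    cutT r ρ + cutS r ρ * ρ = 1 + max 0 (ρ - r + 2) * ρ := by
  rw [cutT_of_le h, cutS_eq_max_min (by linarith), min_eq_right (by linarith)]

theorem cutT_add_cutS_mul_of_ge (hr : 0 < r) (h : r - 1 ≤ ρ) :
    cutT r ρ + cutS r ρ * ρ = r := by
  rcases le_total ρ r with hρ | hρ
  · rw [cutS_of_shell h hρ, cutT_eq_max_min, min_eq_right (by linarith),
      max_eq_right (by linarith)]
    ring
  · rw [cutT_of_ge hρ, cutS_mul_of_ge hr hρ, zero_add]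

theorem monotoneOn_cutT_add_cutS_mul (hr : 0 < r) :
    MonotoneOn (fun ρ ↦ cutT r ρ + cutS r ρ * ρ) (Set.Ici 0) := by
  have inner_part {ρ σ : ℝ} (hρ : 0 ≤ ρ) (h : ρ ≤ σ) (hσ : σ ≤ r - 1) :
      cutT r ρ + cutS r ρ * ρ ≤ cutT r σ + cutS r σ * σ := by
    rw [cutT_add_cutS_mul_of_le (h.trans hσ), cutT_add_cutS_mul_of_le hσ]
    gcongr
  intro ρ hρ σ _ h
  rcases le_total σ (r - 1) with hσ | hσ
  · exact inner_part hρ h hσ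
  · simp only [cutT_add_cutS_mul_of_ge hr hσ]
    rcases le_total ρ (r - 1) with hρ' | hρ'
    · exact (inner_part hρ hρ' le_rfl).trans_eq (cutT_add_cutS_mul_of_ge hr le_rfl)
    · exact (cutT_add_cutS_mul_of_ge hr hρ').le

-- `t` decreases only on the shell `r - 1 ≤ ρ ≤ r`, at rate one, and there `s = 1`.
theorem cutT_sub_le_cutS_mul (hr : 0 < r) (hρ : 0 ≤ ρ) (h : ρ ≤ σ) :
    cutT r ρ - cutT r σ ≤ cutS r ρ * (σ - ρ) ∨ cutT r ρ - cutT r σ ≤ cutS r σ * (σ - ρ) := by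
  have hsub := cutT_sub_le (r := r) h
  have cutS_mul_nonneg (τ : ℝ) : 0 ≤ cutS r τ * (σ - ρ) :=
    mul_nonneg (cutS_mem_Icc hr).1 (sub_nonneg.2 h)
  rcases le_total r ρ with hrρ | hρr
  · left
    rw [cutT_of_ge hrρ, cutT_of_ge (hrρ.trans h), sub_zero]
    exact cutS_mul_nonneg ρ
  rcases le_total (r - 1) ρ with hρ' | hρ'
  · left
    rwa [cutS_of_shell hρ' hρr, one_mul]
  right
  rcases le_total σ (r - 1) with hσ' | hσ'
  · rw [cutT_of_le hρ', cutT_of_le hσ', sub_self]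
    exact cutS_mul_nonneg σ
  rcases le_total σ r with hσr | hrσ
  · rwa [cutS_of_shell hσ' hσr, one_mul]
  · have hσ : cutS r σ * σ = r := cutS_mul_of_ge hr hrσ
    rw [cutT_of_le hρ', cutT_of_ge hrσ]
    nlinarith [mul_le_mul_of_nonneg_right (cutS_mem_Icc (ρ := σ) hr).2 hρ]

theorem abs_cutS_sub_le_of_le (h : ρ ≤ σ) (hσ : σ ≤ r) : |cutS r ρ - cutS r σ| ≤ σ - ρ := by
  rw [cutS_eq_max_min (h.trans hσ), cutS_eq_max_min hσ]
  grind

theorem abs_cutS_sub_mul_le_of_ge (hr : 0 < r) (hρ : r ≤ ρ) (h : ρ ≤ σ) :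
    |cutS r ρ - cutS r σ| * ρ ≤ σ - ρ := by
  have hρ' := cutS_mul_of_ge hr hρ
  have hσ' := cutS_mul_of_ge hr (hρ.trans h)
  obtain ⟨h0, h1⟩ := cutS_mem_Icc (ρ := σ) hr
  rw [← abs_of_pos (hr.trans_le hρ), ← abs_mul, abs_of_pos (hr.trans_le hρ), sub_mul, abs_le]
  constructor <;> nlinarith

theorem abs_cutS_sub_mul_le (hr : 0 < r) (hρ : 0 ≤ ρ) (h : ρ ≤ σ) :
    |cutS r ρ - cutS r σ| * ρ ≤ (r + 1) * (σ - ρ) := by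
  rcases le_total σ r with hσr | hrσ
  · nlinarith [abs_cutS_sub_le_of_le h hσr, abs_nonneg (cutS r ρ - cutS r σ)]
  rcases le_total r ρ with hrρ | hρr
  · nlinarith [abs_cutS_sub_mul_le_of_ge hr hrρ h]
  · calc |cutS r ρ - cutS r σ| * ρ
        ≤ (|cutS r ρ - cutS r r| + |cutS r r - cutS r σ|) * r := by
          gcongr
          exact abs_sub_le _ _ _
      _ = r * |cutS r ρ - cutS r r| + |cutS r r - cutS r σ| * r := by ring
      _ ≤ r * (r - ρ) + (σ - r) := by
          gcongr
          · exact abs_cutS_sub_le_of_le hρr le_rfl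
          · exact abs_cutS_sub_mul_le_of_ge hr le_rfl hrσ
      _ ≤ (r + 1) * (σ - ρ) := by nlinarith

end Cutoff

section InnerProduct

variable {V : Type*} [NormedAddCommGroup V] [InnerProductSpace ℝ V]

theorem norm_smul_sub_smul_sq (a b : ℝ) (x y : V) :
    ‖a • x - b • y‖ ^ 2 =
      (a * ‖x‖ - b * ‖y‖) ^ 2 + a * b * (‖x - y‖ ^ 2 - (‖y‖ - ‖x‖) ^ 2) := by
  simp only [@norm_sub_sq_real V, norm_smul, mul_pow, Real.norm_eq_abs, sq_abs,
    real_inner_smul_left, real_inner_smul_right]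
  ring

theorem norm_smul_sub_le_iff {c : ℝ} (hc : 0 ≤ c) {p v : V} :
    ‖c • v - p‖ ≤ c * ‖v‖ ↔ ‖p‖ ^ 2 ≤ 2 * c * inner ℝ p v := by
  rw [← sq_le_sq₀ (norm_nonneg _) (by positivity), norm_sub_sq_real, norm_smul,
    real_inner_smul_left, real_inner_comm, Real.norm_of_nonneg hc]
  constructor <;> intro h <;> linarith

theorem inner_nonneg_of_norm_sq_le_mul_inner {c : ℝ} (hc : 0 ≤ c) {p v : V}
    (h : ‖p‖ ^ 2 ≤ c * inner ℝ p v) : 0 ≤ inner ℝ p v := by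
  rcases hc.eq_or_lt with rfl | hc
  · have hp : p = 0 := by simpa using h
    rw [hp, inner_zero_left]
  · exact nonneg_of_mul_nonneg_right ((sq_nonneg _).trans h) hc

theorem norm_add_sq_le_mul_inner {a b : ℝ} (ha : 0 ≤ a) (hb : 0 ≤ b) {p q v : V}
    (hp : ‖p‖ ^ 2 ≤ a * inner ℝ p v) (hq : ‖q‖ ^ 2 ≤ b * inner ℝ q v) :
    ‖p + q‖ ^ 2 ≤ (a + b) * inner ℝ (p + q) v := by
  have half {c : ℝ} (hc : 0 ≤ c) {w : V} (hw : ‖w‖ ^ 2 ≤ c * inner ℝ w v) :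
      ‖(c / 2) • v - w‖ ≤ c / 2 * ‖v‖ :=
    (norm_smul_sub_le_iff (by positivity)).2 (by linarith)
  have hsum : ‖((a + b) / 2) • v - (p + q)‖ ≤ (a + b) / 2 * ‖v‖ :=
    calc ‖((a + b) / 2) • v - (p + q)‖
        = ‖((a / 2) • v - p) + ((b / 2) • v - q)‖ := by congr 1; module
      _ ≤ a / 2 * ‖v‖ + b / 2 * ‖v‖ := norm_add_le_of_le (half ha hp) (half hb hq)
      _ = (a + b) / 2 * ‖v‖ := by ring
  linarith [(norm_smul_sub_le_iff (by positivity)).1 hsum]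

theorem norm_smul_sub_smul_le {N a b T : ℝ} (ha : a ∈ Set.Icc 0 N) (hb : b ∈ Set.Icc 0 N)
    {x y : V} (hxy : ‖x‖ ≤ ‖y‖) (hmono : a * ‖x‖ ≤ b * ‖y‖)
    (hgap : b * ‖y‖ - a * ‖x‖ + T ≤ N * (‖y‖ - ‖x‖))
    (hT : T ≤ (N - a) * (‖y‖ - ‖x‖) ∨ T ≤ (N - b) * (‖y‖ - ‖x‖)) :
    ‖a • x - b • y‖ ≤ N * ‖x - y‖ - T := by
  have hN : 0 ≤ N := ha.1.trans ha.2
  set D := ‖x - y‖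
  set δ := ‖y‖ - ‖x‖
  have : 0 ≤ δ := sub_nonneg.2 hxy
  have hδD : δ ≤ D := (norm_sub_norm_le y x).trans_eq (norm_sub_rev y x)
  have haN : (N - a) * N ≤ N ^ 2 - a * b := by nlinarith [ha.1, hb.2]
  have hbN : (N - b) * N ≤ N ^ 2 - a * b := by nlinarith [hb.1, ha.2]
  have hNT : 2 * N * T ≤ (N ^ 2 - a * b) * (D + δ) := by
    have of_le {q : ℝ} (hq : 0 ≤ q) (hqN : q * N ≤ N ^ 2 - a * b) (hTq : T ≤ q * δ) :
        2 * N * T ≤ (N ^ 2 - a * b) * (D + δ) :=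
      calc 2 * N * T ≤ 2 * N * (q * δ) := by gcongr
        _ = q * N * (δ + δ) := by ring
        _ ≤ (N ^ 2 - a * b) * (D + δ) := by gcongr; exact (mul_nonneg hq hN).trans hqN
    exact hT.elim (of_le (sub_nonneg.2 ha.2) haN) (of_le (sub_nonneg.2 hb.2) hbN)
  have hradial : (a * ‖x‖ - b * ‖y‖) ^ 2 ≤ (N * δ - T) ^ 2 := by
    rw [← neg_sub, neg_sq]
    exact pow_le_pow_left₀ (by linarith) (by linarith) 2
  have hND : 0 ≤ N * D - T := by nlinarith
  refine (sq_le_sq₀ (norm_nonneg _) hND).1 ?_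
  rw [norm_smul_sub_smul_sq]
  nlinarith [mul_nonneg (sub_nonneg.2 hδD) (sub_nonneg.2 hNT)]

end InnerProduct

theorem norm_sub_le_of_eventually_nhdsGT {V : Type*} [NormedAddCommGroup V] {f : ℝ → V}
    {a b C : ℝ} (hab : a ≤ b) (hf : ContinuousOn f (Set.Icc a b))
    (hC : ∀ s ∈ Set.Ico a b, ∀ᶠ z in 𝓝[>] s, ‖f z - f s‖ ≤ C * (z - s)) :
    ‖f b - f a‖ ≤ C * (b - a) := by
  refine image_le_of_liminf_slope_right_le_deriv_boundary (f := fun z ↦ ‖f z - f a‖)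
    (B := fun z ↦ C * (z - a)) (B' := fun _ ↦ C) (by fun_prop) (by simp) (by fun_prop)
    (fun z _ ↦ by simpa using (((hasDerivWithinAt_id z (Set.Ici z)).sub_const a).const_mul C))
    (fun s hs ρ hρ ↦ Filter.Eventually.frequently ?_) (Set.right_mem_Icc.2 hab)
  filter_upwards [hC s hs, self_mem_nhdsWithin] with z hz hsz
  have hzs : 0 < z - s := sub_pos.2 hsz
  rw [slope_def_field, div_lt_iff₀ hzs]
  calc ‖f z - f a‖ - ‖f s - f a‖ ≤ ‖f z - f a - (f s - f a)‖ := norm_sub_norm_le _ _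
    _ = ‖f z - f s‖ := by rw [sub_sub_sub_cancel_right]
    _ ≤ C * (z - s) := hz
    _ < ρ * (z - s) := by gcongr

section BaillonHaddad

variable {V : Type*} [NormedAddCommGroup V] [InnerProductSpace ℝ V]

/-- A monotone vector field on `S`, in the sense of convex analysis. -/
def MonotoneFieldOn (g : V → V) (S : Set V) : Prop :=
  ∀ x ∈ S, ∀ y ∈ S, 0 ≤ inner ℝ (g x - g y) (x - y)

/-- A vector field on `S` which is Lipschitz in the direction of the increment only. -/
def OneSidedLipschitzOn (c : ℝ) (g : V → V) (S : Set V) : Prop :=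
  ∀ x ∈ S, ∀ y ∈ S, inner ℝ (g x - g y) (x - y) ≤ c * ‖x - y‖ ^ 2

/-- A cocoercive vector field on `S`; the constant multiplies the inner product, so that a
`c`-cocoercive field is monotone and `c`-Lipschitz. -/
def CocoerciveOn (c : ℝ) (g : V → V) (S : Set V) : Prop :=
  ∀ x ∈ S, ∀ y ∈ S, ‖g x - g y‖ ^ 2 ≤ c * inner ℝ (g x - g y) (x - y)

variable [CompleteSpace V] {w : V → ℝ} {g : V → V} {S : Set V} {c : ℝ} {x y : V}

theorem le_add_inner_gradient_add_sq (hS : Convex ℝ S) (hw : ∀ z ∈ S, HasGradientAt w (g z) z)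
    (hg : OneSidedLipschitzOn c g S) (hx : x ∈ S) (hy : y ∈ S) :
    w y ≤ w x + inner ℝ (g x) (y - x) + c / 2 * ‖y - x‖ ^ 2 := by
  set v := y - x with hv
  have hseg (s : ℝ) (hs : s ∈ Set.Icc (0 : ℝ) 1) : x + s • v ∈ S := hS.add_smul_sub_mem hx hy hs
  set φ : ℝ → ℝ := fun s ↦ w (x + s • v) - s * inner ℝ (g x) v - s ^ 2 * (c / 2 * ‖v‖ ^ 2) with hφ
  have hφ' (s : ℝ) (hs : s ∈ Set.Icc (0 : ℝ) 1) :
      HasDerivAt φ (inner ℝ (g (x + s • v) - g x) v - s * (c * ‖v‖ ^ 2)) s := by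
    have hline : HasDerivAt (fun s : ℝ ↦ x + s • v) v s := by
      simpa using ((hasDerivAt_id s).smul_const v).const_add x
    have hws := (hw _ (hseg s hs)).hasFDerivAt.comp_hasDerivAt s hline
    refine ((hws.sub ((hasDerivAt_id s).mul_const _)).sub
      ((hasDerivAt_pow 2 s).mul_const _)).congr_deriv ?_
    simp only [InnerProductSpace.toDual_apply_apply, inner_sub_left]
    push_cast
    ring
  have hanti : AntitoneOn φ (Set.Icc 0 1) := by
    refine antitoneOn_of_deriv_nonpos (convex_Icc 0 1)
      (fun s hs ↦ (hφ' s hs).continuousAt.continuousWithinAt)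
      (fun s hs ↦ (hφ' s (interior_subset hs)).differentiableAt.differentiableWithinAt)
      fun s hs ↦ ?_
    rw [interior_Icc] at hs
    have hsI := Set.Ioo_subset_Icc_self hs
    have hgs := hg _ (hseg s hsI) x hx
    rw [add_sub_cancel_left, inner_smul_right, norm_smul, Real.norm_of_nonneg hs.1.le] at hgs
    rw [(hφ' s hsI).deriv, sub_nonpos]
    exact le_of_mul_le_mul_left (hgs.trans_eq (by ring)) hs.1
  have h01 := hanti (Set.left_mem_Icc.2 zero_le_one) (Set.right_mem_Icc.2 zero_le_one) zero_le_one
  simp only [hφ, hv, one_smul, zero_smul, add_zero, add_sub_cancel] at h01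
  linarith

theorem add_inner_gradient_le (hS : Convex ℝ S) (hw : ∀ z ∈ S, HasGradientAt w (g z) z)
    (hg : MonotoneFieldOn g S) (hx : x ∈ S) (hy : y ∈ S) :
    w x + inner ℝ (g x) (y - x) ≤ w y := by
  have hneg : OneSidedLipschitzOn 0 (-g) S := fun a ha b hb ↦ by
    rw [Pi.neg_apply, Pi.neg_apply, neg_sub_neg, ← neg_sub, inner_neg_left, zero_mul]
    exact neg_nonpos.2 (hg a ha b hb)
  have hw' (z : V) (hz : z ∈ S) : HasGradientAt (-w) ((-g) z) z := by
    rw [hasGradientAt_iff_hasFDerivAt, Pi.neg_apply, map_neg]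
    exact (hw z hz).hasFDerivAt.neg
  have := le_add_inner_gradient_add_sq hS hw' hneg hx hy
  simp only [Pi.neg_apply, inner_neg_left] at this
  linarith

-- Compare the convexity lower bound at `y - c⁻¹ (g y - g x)`, the minimiser of the quadratic upper
-- bound around `y`, with that upper bound.
theorem add_inner_gradient_add_sq_le (hS : Convex ℝ S) (hw : ∀ z ∈ S, HasGradientAt w (g z) z)
    (hc : 0 < c) (hmono : MonotoneFieldOn g S) (hg : OneSidedLipschitzOn c g S)
    (hx : x ∈ S) (hy : y ∈ S) (hy' : y - c⁻¹ • (g y - g x) ∈ S) :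
    w x + inner ℝ (g x) (y - x) + c⁻¹ / 2 * ‖g y - g x‖ ^ 2 ≤ w y := by
  have hlower := add_inner_gradient_le hS hw hmono hx hy'
  have hupper := le_add_inner_gradient_add_sq hS hw hg hy hy'
  rw [sub_right_comm, inner_sub_right, inner_smul_right] at hlower
  rw [sub_sub_cancel_left, inner_neg_right, norm_neg, norm_smul, inner_smul_right,
    Real.norm_of_nonneg (inv_pos.2 hc).le] at hupper
  have hsq : inner ℝ (g y) (g y - g x) - inner ℝ (g x) (g y - g x) = ‖g y - g x‖ ^ 2 := by
    rw [← inner_sub_left, real_inner_self_eq_norm_sq]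
  have hcc : c / 2 * (c⁻¹ * ‖g y - g x‖) ^ 2 = c⁻¹ / 2 * ‖g y - g x‖ ^ 2 := by field_simp
  linear_combination hlower + hupper + hcc - c⁻¹ * hsq

theorem norm_gradient_sub_sq_le_of_mem (hS : Convex ℝ S)
    (hw : ∀ z ∈ S, HasGradientAt w (g z) z) (hc : 0 < c) (hmono : MonotoneFieldOn g S)
    (hg : OneSidedLipschitzOn c g S) (hx : x ∈ S) (hy : y ∈ S)
    (hx' : x - c⁻¹ • (g x - g y) ∈ S) (hy' : y - c⁻¹ • (g y - g x) ∈ S) :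
    ‖g x - g y‖ ^ 2 ≤ c * inner ℝ (g x - g y) (x - y) := by
  have hxy := add_inner_gradient_add_sq_le hS hw hc hmono hg hx hy hy'
  have hyx := add_inner_gradient_add_sq_le hS hw hc hmono hg hy hx hx'
  rw [norm_sub_rev, ← neg_sub x y, inner_neg_right] at hxy
  rw [← inv_mul_le_iff₀ hc, inner_sub_left]
  linarith

/- The gradient steps of the previous lemma stay in `S` for points which are close to each other;
cocoercivity in the form `norm_smul_sub_le_iff` then adds up along the segment. -/
theorem cocoerciveOn_of_hasGradientAt_of_pos (hS : Convex ℝ S) (hSo : IsOpen S)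
    (hw : ∀ z ∈ S, HasGradientAt w (g z) z) (hcont : ContinuousOn g S) (hc : 0 < c)
    (hmono : MonotoneFieldOn g S) (hg : OneSidedLipschitzOn c g S) : CocoerciveOn c g S := by
  intro x hx y hy
  have local_bound (z : V) (hz : z ∈ S) :
      ∀ᶠ a in 𝓝 z, ‖(c / 2) • (a - z) - (g a - g z)‖ ≤ c / 2 * ‖a - z‖ := by
    have hgz := (hcont z hz).continuousAt (hSo.mem_nhds hz)
    have step_mem {f : V → V} (hf : ContinuousAt f z) (hfz : f z = z) : ∀ᶠ a in 𝓝 z, f a ∈ S :=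
      hf.eventually_mem (hSo.mem_nhds (hfz.symm ▸ hz))
    filter_upwards [hSo.mem_nhds hz,
      step_mem (f := fun a ↦ a - c⁻¹ • (g a - g z)) (by fun_prop) (by simp),
      step_mem (f := fun a ↦ z - c⁻¹ • (g z - g a)) (by fun_prop) (by simp)] with a ha ha' hz'
    rw [norm_smul_sub_le_iff (by positivity)]
    exact (norm_gradient_sub_sq_le_of_mem hS hw hc hmono hg ha hz ha' hz').trans_eq (by ring)
  set p : ℝ → V := fun s ↦ y + s • (x - y) with hp
  have hpS (s : ℝ) (hs : s ∈ Set.Icc (0 : ℝ) 1) : p s ∈ S := hS.add_smul_sub_mem hy hx hs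
  have hpc : Continuous p := by fun_prop
  have hgp : ContinuousOn (fun s ↦ g (p s)) (Set.Icc 0 1) := hcont.comp hpc.continuousOn hpS
  have hdiff := norm_sub_le_of_eventually_nhdsGT (C := c / 2 * ‖x - y‖)
    (f := fun s ↦ (c / 2) • p s - g (p s)) zero_le_one
    ((hpc.const_smul _).continuousOn.sub hgp) fun s hs ↦ by
      have hnear := hpc.continuousAt.eventually (local_bound _ (hpS s (Set.Ico_subset_Icc_self hs)))
      filter_upwards [hnear.filter_mono nhdsWithin_le_nhds, self_mem_nhdsWithin] with z hz hsz
      have hpz : p z - p s = (z - s) • (x - y) := by simp only [hp]; module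
      calc ‖(c / 2) • p z - g (p z) - ((c / 2) • p s - g (p s))‖
          = ‖(c / 2) • (p z - p s) - (g (p z) - g (p s))‖ := by congr 1; module
        _ ≤ c / 2 * ‖p z - p s‖ := hz
        _ = c / 2 * ‖x - y‖ * (z - s) := by
          rw [hpz, norm_smul, Real.norm_of_nonneg (sub_pos.2 hsz).le]
          ring
  simp only [hp, one_smul, zero_smul, add_zero, add_sub_cancel, sub_zero, mul_one] at hdiff
  rw [sub_sub_sub_comm, ← smul_sub, norm_smul_sub_le_iff (by positivity)] at hdiff
  exact hdiff.trans_eq (by ring)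

theorem cocoerciveOn_of_hasGradientAt (hS : Convex ℝ S) (hSo : IsOpen S)
    (hw : ∀ z ∈ S, HasGradientAt w (g z) z) (hcont : ContinuousOn g S) (hc : 0 ≤ c)
    (hmono : MonotoneFieldOn g S) (hg : OneSidedLipschitzOn c g S) : CocoerciveOn c g S := by
  intro x hx y hy
  have hlim : Filter.Tendsto (fun C ↦ C * inner ℝ (g x - g y) (x - y)) (𝓝[>] c)
      (𝓝 (c * inner ℝ (g x - g y) (x - y))) :=
    (Continuous.tendsto (by fun_prop) c).mono_left nhdsWithin_le_nhds
  refine ge_of_tendsto hlim ?_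
  filter_upwards [self_mem_nhdsWithin] with C hC
  refine cocoerciveOn_of_hasGradientAt_of_pos hS hSo hw hcont (hc.trans_lt hC) hmono
    (fun a ha b hb ↦ (hg a ha b hb).trans ?_) x hx y hy
  exact mul_le_mul_of_nonneg_right (Set.mem_Ioi.1 hC).le (sq_nonneg _)

end BaillonHaddad

section Drift

variable {d : ℕ} {h : E d → E d} {m r M : ℝ} {K : ℝ≥0}

/-- The tamed drift `t(x) g(x) + R s(x) x + m x` at an arbitrary taming radius `r`. -/
noncomputable def tamedDriftAt (h : E d → E d) (m r : ℝ) (x : E d) : E d :=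
  cutT r ‖x‖ • gDrift h m x + (tamingSup h m r * cutS r ‖x‖) • x + m • x

/-- The increment `R s(x) x - R s(y) y + (t(x) - t(y)) g(x)` of the tamed drift without `m x`
and without the part `t(y) (g(x) - g(y))`, which for `|x| ≤ |y|` is treated separately. -/
noncomputable def radialIncr (h : E d → E d) (m r : ℝ) (x y : E d) : E d :=
  (tamingSup h m r * cutS r ‖x‖) • x - (tamingSup h m r * cutS r ‖y‖) • y +
    (cutT r ‖x‖ - cutT r ‖y‖) • gDrift h m x

theorem tamedDriftAt_sub_sub_smul (x y : E d) :
    tamedDriftAt h m r x - m • x - (tamedDriftAt h m r y - m • y) =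
      cutT r ‖y‖ • (gDrift h m x - gDrift h m y) + radialIncr h m r x y := by
  unfold tamedDriftAt radialIncr
  module

theorem monotoneFieldOn_gDrift (hconv : StrongMonotone h (m / 2)) (S : Set (E d)) :
    MonotoneFieldOn (gDrift h m) S := fun x _ y _ ↦ by
  have hsub : gDrift h m x - gDrift h m y = h x - h y - m • (x - y) := by
    unfold gDrift
    module
  rw [hsub, inner_sub_left, real_inner_smul_left, real_inner_self_eq_norm_sq]
  linarith [hconv x y]

theorem lipschitzOnWith_gDrift {S : Set (E d)} (hh : LipschitzOnWith K h S) (m : ℝ) :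
    LipschitzOnWith (K + ‖m‖₊) (gDrift h m) S :=
  hh.sub (lipschitzWith_smul m).lipschitzOnWith

theorem hasGradientAt_sub_norm_sq {u : E d → ℝ} (hu : Differentiable ℝ u) (m : ℝ) (z : E d) :
    HasGradientAt (fun x ↦ u x - m / 2 * ‖x‖ ^ 2) (gDrift (gradient u) m z) z := by
  have hu' := (hu z).hasGradientAt.hasFDerivAt
  have hsq := (hasStrictFDerivAt_norm_sq z).hasFDerivAt.const_mul (m / 2)
  rw [hasGradientAt_iff_hasFDerivAt]
  refine (hu'.sub hsq).congr_fderiv ?_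
  ext v
  simp [gDrift]
  ring

theorem tamingSup_nonneg : 0 ≤ tamingSup h m r := by
  refine Real.sSup_nonneg ?_
  rintro _ ⟨y, _, rfl⟩
  exact norm_nonneg _

theorem norm_gDrift_le_tamingSup (hg : LipschitzOnWith K (gDrift h m) (Metric.ball 0 r))
    {x : E d} (hx : ‖x‖ < r) : ‖gDrift h m x‖ ≤ tamingSup h m r := by
  refine le_csSup ⟨‖gDrift h m x‖ + K * (r + r), ?_⟩ ⟨x, mem_ball_zero_iff.2 hx, rfl⟩
  rintro _ ⟨y, hy, rfl⟩
  have hy' := mem_ball_zero_iff.1 hy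
  refine norm_le_norm_add_norm_sub' _ (gDrift h m x) |>.trans (add_le_add_right ?_ _)
  refine (hg.norm_sub_le hy (mem_ball_zero_iff.2 hx)).trans ?_
  gcongr
  exact norm_sub_le_of_le hy'.le hx.le

theorem norm_cutT_sub_smul_gDrift_le (hg : LipschitzOnWith K (gDrift h m) (Metric.ball 0 r))
    {x y : E d} (hxy : ‖x‖ ≤ ‖y‖) :
    ‖(cutT r ‖x‖ - cutT r ‖y‖) • gDrift h m x‖ ≤
      tamingSup h m r * (cutT r ‖x‖ - cutT r ‖y‖) := by
  have hτ : 0 ≤ cutT r ‖x‖ - cutT r ‖y‖ := sub_nonneg.2 (cutT_antitone r hxy)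
  rw [norm_smul, Real.norm_of_nonneg hτ, mul_comm]
  rcases lt_or_ge ‖x‖ r with hx | hx
  · exact mul_le_mul_of_nonneg_right (norm_gDrift_le_tamingSup hg hx) hτ
  · simp only [cutT_of_ge hx, cutT_of_ge (hx.trans hxy), sub_zero, mul_zero, le_refl]

theorem norm_cutT_smul_gDrift_sub_le (hg : LipschitzOnWith K (gDrift h m) (Metric.ball 0 r))
    {x y : E d} (hxy : ‖x‖ ≤ ‖y‖) :
    ‖cutT r ‖y‖ • (gDrift h m x - gDrift h m y)‖ ≤ K * ‖x - y‖ := by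
  rw [norm_smul, Real.norm_of_nonneg cutT_nonneg]
  rcases lt_or_ge ‖y‖ r with hy | hy
  · refine (mul_le_of_le_one_left (norm_nonneg _) cutT_le_one).trans ?_
    exact hg.norm_sub_le (mem_ball_zero_iff.2 (hxy.trans_lt hy)) (mem_ball_zero_iff.2 hy)
  · rw [cutT_of_ge hy, zero_mul]
    positivity

theorem norm_cutS_smul_sub_le {V : Type*} [NormedAddCommGroup V] [NormedSpace ℝ V]
    (hr : 0 < r) {x y : V} (hxy : ‖x‖ ≤ ‖y‖) :
    ‖cutS r ‖x‖ • x - cutS r ‖y‖ • y‖ ≤ (r + 2) * ‖x - y‖ :=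
  calc ‖cutS r ‖x‖ • x - cutS r ‖y‖ • y‖
      = ‖(cutS r ‖x‖ - cutS r ‖y‖) • x + cutS r ‖y‖ • (x - y)‖ := by congr 1; module
    _ ≤ |cutS r ‖x‖ - cutS r ‖y‖| * ‖x‖ + cutS r ‖y‖ * ‖x - y‖ := by
      refine (norm_add_le _ _).trans_eq ?_
      rw [norm_smul, norm_smul, Real.norm_eq_abs, Real.norm_of_nonneg (cutS_mem_Icc hr).1]
    _ ≤ (r + 1) * (‖y‖ - ‖x‖) + 1 * ‖x - y‖ := by
      exact add_le_add (abs_cutS_sub_mul_le hr (norm_nonneg x) hxy)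
        (mul_le_mul_of_nonneg_right (cutS_mem_Icc hr).2 (norm_nonneg _))
    _ ≤ (r + 1) * ‖x - y‖ + 1 * ‖x - y‖ := by
      gcongr
      exact (norm_sub_norm_le y x).trans_eq (norm_sub_rev y x)
    _ = (r + 2) * ‖x - y‖ := by ring

theorem norm_radialIncr_le (hr : 0 < r)
    (hg : LipschitzOnWith K (gDrift h m) (Metric.ball 0 r)) {x y : E d} (hxy : ‖x‖ ≤ ‖y‖) :
    ‖radialIncr h m r x y‖ ≤ tamingSup h m r * (r + 3) * ‖x - y‖ := by
  have hR : 0 ≤ tamingSup h m r := tamingSup_nonneg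
  calc ‖radialIncr h m r x y‖
      ≤ tamingSup h m r * ‖cutS r ‖x‖ • x - cutS r ‖y‖ • y‖ +
          tamingSup h m r * (cutT r ‖x‖ - cutT r ‖y‖) := by
        rw [radialIncr, mul_smul, mul_smul, ← smul_sub]
        refine (norm_add_le _ _).trans (add_le_add ?_ (norm_cutT_sub_smul_gDrift_le hg hxy))
        rw [norm_smul, Real.norm_of_nonneg hR]
    _ ≤ tamingSup h m r * ((r + 2) * ‖x - y‖) + tamingSup h m r * ‖x - y‖ := by
        gcongr
        · exact norm_cutS_smul_sub_le hr hxy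
        · exact (cutT_sub_le hxy).trans ((norm_sub_norm_le y x).trans_eq (norm_sub_rev y x))
    _ = tamingSup h m r * (r + 3) * ‖x - y‖ := by ring

theorem exists_lipschitzWith_tamedDriftAt (hr : 0 < r)
    (hg : LipschitzOnWith K (gDrift h m) (Metric.ball 0 r)) :
    ∃ C : ℝ≥0, LipschitzWith C (tamedDriftAt h m r) := by
  have : 0 ≤ tamingSup h m r := tamingSup_nonneg
  obtain ⟨C, hC⟩ : ∃ C : ℝ≥0, LipschitzWith C fun x ↦ tamedDriftAt h m r x - m • x := by
    refine ⟨(K + tamingSup h m r * (r + 3)).toNNReal, LipschitzWith.of_dist_le' fun x y ↦ ?_⟩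
    wlog hxy : ‖x‖ ≤ ‖y‖ generalizing x y
    · rw [dist_comm, dist_comm x]
      exact this y x (le_of_not_ge hxy)
    rw [dist_eq_norm, dist_eq_norm, tamedDriftAt_sub_sub_smul, add_mul]
    exact norm_add_le_of_le (norm_cutT_smul_gDrift_sub_le hg hxy) (norm_radialIncr_le hr hg hxy)
  refine ⟨C + ‖m‖₊, ?_⟩
  simpa only [sub_add_cancel] using hC.add (lipschitzWith_smul m)

theorem lipschitzWith_lipConst {f : E d → E d} (hf : LipschitzWith K f) :
    LipschitzWith (lipConst f) f := by
  refine LipschitzWith.of_dist_le_mul fun x y ↦ ?_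
  rcases (dist_nonneg (x := x) (y := y)).eq_or_lt' with hxy | hxy
  · simpa only [hxy, mul_zero] using hf.dist_le_mul x y
  · rw [← div_le_iff₀ hxy, ← Real.toNNReal_le_iff_le_coe]
    refine le_csInf ⟨K, hf⟩ fun C hC ↦ ?_
    rw [Real.toNNReal_le_iff_le_coe, div_le_iff₀ hxy]
    exact hC.dist_le_mul x y

theorem oneSidedLipschitzOn_of_lipConst_le {f : E d → E d} (hf : LipschitzWith K f)
    (hM : lipConst f ≤ M) (S : Set (E d)) : OneSidedLipschitzOn M f S := fun x _ y _ ↦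
  calc inner ℝ (f x - f y) (x - y) ≤ ‖f x - f y‖ * ‖x - y‖ := real_inner_le_norm _ _
    _ ≤ M * ‖x - y‖ * ‖x - y‖ := by
      gcongr
      exact ((lipschitzWith_lipConst hf).norm_sub_le x y).trans (by gcongr)
    _ = M * ‖x - y‖ ^ 2 := by ring

end Drift

section Cocoercive

variable {d : ℕ} {h : E d → E d} {m r M ρ σ : ℝ} {K : ℝ≥0}

theorem cutT_mul_inner_add_inner_radialIncr_le
    (hM : OneSidedLipschitzOn M (tamedDriftAt h m r) Set.univ) (x y : E d) :
    cutT r ‖y‖ * inner ℝ (gDrift h m x - gDrift h m y) (x - y) +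
      inner ℝ (radialIncr h m r x y) (x - y) ≤ (M - m) * ‖x - y‖ ^ 2 := by
  have hle := hM x trivial y trivial
  rw [← real_inner_smul_left, ← inner_add_left, ← tamedDriftAt_sub_sub_smul,
    sub_sub_sub_comm, ← smul_sub, inner_sub_left, real_inner_smul_left, real_inner_self_eq_norm_sq]
  linarith

theorem exists_norm_eq_one (hd : 0 < d) : ∃ e : E d, ‖e‖ = 1 :=
  ⟨EuclideanSpace.single ⟨0, hd⟩ 1, by simp⟩

theorem tamingSup_le (hd : 0 < d) (hr : 0 < r)
    (hM : OneSidedLipschitzOn M (tamedDriftAt h m r) Set.univ) : tamingSup h m r ≤ M - m := by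
  obtain ⟨e, he⟩ := exists_norm_eq_one hd
  have hle := cutT_mul_inner_add_inner_radialIncr_le hM (r • e) (-(r • e))
  have hincr : radialIncr h m r (r • e) (-(r • e)) = (tamingSup h m r * (2 * r)) • e := by
    rw [radialIncr, norm_neg, norm_smul, he, mul_one, Real.norm_of_nonneg hr.le,
      cutS_of_shell (by linarith) le_rfl]
    module
  have hsub : r • e - -(r • e) = (2 * r) • e := by module
  rw [hincr, hsub, norm_neg, norm_smul, norm_smul, he, mul_one, mul_one, Real.norm_of_nonneg hr.le,
    Real.norm_of_nonneg (by positivity), cutT_of_ge le_rfl, zero_mul, zero_add,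
    real_inner_smul_left, real_inner_smul_right, real_inner_self_eq_norm_sq, he] at hle
  refine le_of_mul_le_mul_right (hle.trans_eq' ?_) (by positivity : 0 < (2 * r) ^ 2)
  ring

theorem tamingSup_mul_cutS_mul_sub_le_of_le (hd : 0 < d) (hconv : StrongMonotone h (m / 2))
    (hM : OneSidedLipschitzOn M (tamedDriftAt h m r) Set.univ)
    (hρ : 0 ≤ ρ) (hρσ : ρ ≤ σ) (hσ : σ ≤ r - 1) :
    tamingSup h m r * (cutS r σ * σ - cutS r ρ * ρ) ≤ (M - m) * (σ - ρ) := by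
  rcases hρσ.eq_or_lt with rfl | hlt
  · simp
  obtain ⟨e, he⟩ := exists_norm_eq_one hd
  have norm_ray {τ : ℝ} (hτ : 0 ≤ τ) : ‖τ • e‖ = τ := by
    rw [norm_smul, he, mul_one, Real.norm_of_nonneg hτ]
  have hle := cutT_mul_inner_add_inner_radialIncr_le hM (σ • e) (ρ • e)
  have hmono := monotoneFieldOn_gDrift hconv Set.univ (σ • e) trivial (ρ • e) trivial
  have hincr : radialIncr h m r (σ • e) (ρ • e) =
      (tamingSup h m r * (cutS r σ * σ - cutS r ρ * ρ)) • e := by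
    rw [radialIncr, norm_ray hρ, norm_ray (hρ.trans hρσ), cutT_of_le hσ, cutT_of_le (hρσ.trans hσ)]
    module
  rw [hincr, ← sub_smul, norm_ray (sub_nonneg.2 hρσ), norm_ray hρ, cutT_of_le (hρσ.trans hσ),
    one_mul, real_inner_smul_left, real_inner_smul_right, real_inner_smul_right,
    real_inner_self_eq_norm_sq, he] at hle
  rw [← sub_smul, real_inner_smul_right] at hmono
  refine le_of_mul_le_mul_right (?_ : _ ≤ (M - m) * (σ - ρ) * (σ - ρ)) (sub_pos.2 hlt)
  linarith

theorem tamingSup_mul_cutS_mul_sub_le_of_ge (hd : 0 < d) (hr : 0 < r)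
    (hM : OneSidedLipschitzOn M (tamedDriftAt h m r) Set.univ)
    (hρ : r - 1 ≤ ρ) (hρσ : ρ ≤ σ) :
    tamingSup h m r * (cutS r σ * σ - cutS r ρ * ρ) ≤ (M - m) * (σ - ρ) := by
  have hprofile : cutS r σ * σ - cutS r ρ * ρ ≤ σ - ρ := by
    linarith [cutT_add_cutS_mul_of_ge hr hρ, cutT_add_cutS_mul_of_ge hr (hρ.trans hρσ),
      cutT_sub_le (r := r) hρσ]
  calc tamingSup h m r * (cutS r σ * σ - cutS r ρ * ρ)
      ≤ tamingSup h m r * (σ - ρ) := mul_le_mul_of_nonneg_left hprofile tamingSup_nonneg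
    _ ≤ (M - m) * (σ - ρ) := mul_le_mul_of_nonneg_right (tamingSup_le hd hr hM) (by linarith)

theorem tamingSup_mul_cutS_mul_sub_le (hd : 0 < d) (hr : 0 < r)
    (hconv : StrongMonotone h (m / 2))
    (hM : OneSidedLipschitzOn M (tamedDriftAt h m r) Set.univ) (hρ : 0 ≤ ρ) (hρσ : ρ ≤ σ) :
    tamingSup h m r * (cutS r σ * σ - cutS r ρ * ρ) ≤ (M - m) * (σ - ρ) := by
  rcases le_total σ (r - 1) with hσ | hσ
  · exact tamingSup_mul_cutS_mul_sub_le_of_le hd hconv hM hρ hρσ hσ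
  rcases le_total (r - 1) ρ with hρ' | hρ'
  · exact tamingSup_mul_cutS_mul_sub_le_of_ge hd hr hM hρ' hρσ
  · linarith [tamingSup_mul_cutS_mul_sub_le_of_le hd hconv hM hρ hρ' le_rfl,
      tamingSup_mul_cutS_mul_sub_le_of_ge hd hr hM le_rfl hσ]

theorem norm_sq_radialIncr_le (hd : 0 < d) (hr : 0 < r) (hconv : StrongMonotone h (m / 2))
    (hg : LipschitzOnWith K (gDrift h m) (Metric.ball 0 r))
    (hM : OneSidedLipschitzOn M (tamedDriftAt h m r) Set.univ) {x y : E d} (hxy : ‖x‖ ≤ ‖y‖) :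
    ‖radialIncr h m r x y‖ ^ 2 ≤ 2 * (M - m) * inner ℝ (radialIncr h m r x y) (x - y) := by
  have hR : 0 ≤ tamingSup h m r := tamingSup_nonneg
  have hRM := tamingSup_le hd hr hM
  set N := M - m
  set R := tamingSup h m r
  set τ := cutT r ‖x‖ - cutT r ‖y‖
  have hN : 0 ≤ N := hR.trans hRM
  have weight_mem (ρ : ℝ) : N - R * cutS r ρ ∈ Set.Icc 0 N := by
    have hs : R * cutS r ρ ≤ R := mul_le_of_le_one_right hR (cutS_mem_Icc hr).2
    exact ⟨by linarith, sub_le_self _ (mul_nonneg hR (cutS_mem_Icc hr).1)⟩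
  have hprofile := tamingSup_mul_cutS_mul_sub_le hd hr hconv hM (norm_nonneg x) hxy
  have hmono : R * τ ≤ R * (cutS r ‖y‖ * ‖y‖ - cutS r ‖x‖ * ‖x‖) := by
    have := monotoneOn_cutT_add_cutS_mul hr (norm_nonneg x) (norm_nonneg y) hxy
    exact mul_le_mul_of_nonneg_left (by linarith) hR
  have hsub := norm_smul_sub_smul_le (weight_mem ‖x‖) (weight_mem ‖y‖) (T := R * τ) hxy
    (by linarith) (by linarith) <| by
      refine (cutT_sub_le_cutS_mul hr (norm_nonneg x) hxy).imp ?_ ?_ <;> intro hτ <;>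
        rw [sub_sub_cancel, mul_assoc] <;> exact mul_le_mul_of_nonneg_left hτ hR
  rw [← norm_smul_sub_le_iff hN]
  calc ‖N • (x - y) - radialIncr h m r x y‖
      = ‖((N - R * cutS r ‖x‖) • x - (N - R * cutS r ‖y‖) • y) - τ • gDrift h m x‖ := by
        rw [radialIncr]
        congr 1
        module
    _ ≤ (N * ‖x - y‖ - R * τ) + R * τ :=
        norm_sub_le_of_le hsub (norm_cutT_sub_smul_gDrift_le hg hxy)
    _ = N * ‖x - y‖ := sub_add_cancel _ _

theorem inner_radialIncr_nonneg (hd : 0 < d) (hr : 0 < r) (hconv : StrongMonotone h (m / 2))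
    (hg : LipschitzOnWith K (gDrift h m) (Metric.ball 0 r))
    (hM : OneSidedLipschitzOn M (tamedDriftAt h m r) Set.univ) {x y : E d} (hxy : ‖x‖ ≤ ‖y‖) :
    0 ≤ inner ℝ (radialIncr h m r x y) (x - y) :=
  inner_nonneg_of_norm_sq_le_mul_inner
    (mul_nonneg zero_le_two (tamingSup_nonneg.trans (tamingSup_le hd hr hM)))
    (norm_sq_radialIncr_le hd hr hconv hg hM hxy)

theorem oneSidedLipschitzOn_gDrift (hd : 0 < d) (hr : 0 < r) (hconv : StrongMonotone h (m / 2))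
    (hg : LipschitzOnWith K (gDrift h m) (Metric.ball 0 r))
    (hM : OneSidedLipschitzOn M (tamedDriftAt h m r) Set.univ) (hσ : 0 < cutT r σ) :
    OneSidedLipschitzOn ((M - m) / cutT r σ) (gDrift h m) (Metric.ball 0 σ) := by
  intro x hx y hy
  wlog hxy : ‖x‖ ≤ ‖y‖ generalizing x y
  · rw [← inner_neg_neg, neg_sub, neg_sub, norm_sub_rev]
    exact this y hy x hx (le_of_not_ge hxy)
  have hle := cutT_mul_inner_add_inner_radialIncr_le hM x y
  have hradial := inner_radialIncr_nonneg hd hr hconv hg hM hxy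
  have hmono := monotoneFieldOn_gDrift hconv Set.univ x trivial y trivial
  have hcut := cutT_antitone r (mem_ball_zero_iff.1 hy).le
  rw [div_mul_eq_mul_div, le_div_iff₀ hσ]
  linarith [mul_le_mul_of_nonneg_right hcut hmono]

/- Cocoercivity of `g` on the ball of radius `σ` has the constant `(M - m) / t(σ)`; let `σ` decrease
to `|y|`. -/
theorem cutT_mul_norm_gDrift_sub_sq_le {u : E d → ℝ} (hu : Differentiable ℝ u) (hd : 0 < d)
    (hr : 0 < r) (hconv : StrongMonotone (gradient u) (m / 2))
    (hg : LipschitzOnWith K (gDrift (gradient u) m) (Metric.ball 0 r))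
    (hM : OneSidedLipschitzOn M (tamedDriftAt (gradient u) m r) Set.univ) {x y : E d}
    (hxy : ‖x‖ ≤ ‖y‖) :
    cutT r ‖y‖ * ‖gDrift (gradient u) m x - gDrift (gradient u) m y‖ ^ 2 ≤
      (M - m) * inner ℝ (gDrift (gradient u) m x - gDrift (gradient u) m y) (x - y) := by
  have hN : 0 ≤ M - m := tamingSup_nonneg.trans (tamingSup_le hd hr hM)
  have hmono := monotoneFieldOn_gDrift hconv
  rcases le_or_gt r ‖y‖ with hy | hy
  · rw [cutT_of_ge hy, zero_mul]
    exact mul_nonneg hN (hmono Set.univ x trivial y trivial)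
  have hlim : Filter.Tendsto
      (fun σ ↦ cutT r σ * ‖gDrift (gradient u) m x - gDrift (gradient u) m y‖ ^ 2) (𝓝[>] ‖y‖)
      (𝓝 (cutT r ‖y‖ * ‖gDrift (gradient u) m x - gDrift (gradient u) m y‖ ^ 2)) :=
    (((continuous_cutT r).tendsto ‖y‖).mono_left nhdsWithin_le_nhds).mul_const _
  refine le_of_tendsto hlim ?_
  filter_upwards [Ioo_mem_nhdsGT hy] with σ ⟨hyσ, hσr⟩
  have hσ : 0 < cutT r σ := by
    rw [cutT_eq_max_min]
    exact lt_max_of_lt_right (lt_min one_pos (sub_pos.2 hσr))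
  have hcoco := cocoerciveOn_of_hasGradientAt (convex_ball 0 σ) Metric.isOpen_ball
    (fun z _ ↦ hasGradientAt_sub_norm_sq hu m z)
    (hg.continuousOn.mono (Metric.ball_subset_ball hσr.le)) (by positivity) (hmono _)
    (oneSidedLipschitzOn_gDrift hd hr hconv hg hM hσ)
    x (mem_ball_zero_iff.2 (hxy.trans_lt hyσ)) y (mem_ball_zero_iff.2 hyσ)
  rwa [div_mul_eq_mul_div, le_div_iff₀' hσ] at hcoco

theorem norm_sq_cutT_smul_gDrift_sub_le {u : E d → ℝ} (hu : Differentiable ℝ u) (hd : 0 < d)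
    (hr : 0 < r) (hconv : StrongMonotone (gradient u) (m / 2))
    (hg : LipschitzOnWith K (gDrift (gradient u) m) (Metric.ball 0 r))
    (hM : OneSidedLipschitzOn M (tamedDriftAt (gradient u) m r) Set.univ) {x y : E d}
    (hxy : ‖x‖ ≤ ‖y‖) :
    ‖cutT r ‖y‖ • (gDrift (gradient u) m x - gDrift (gradient u) m y)‖ ^ 2 ≤
      (M - m) * inner ℝ (cutT r ‖y‖ • (gDrift (gradient u) m x - gDrift (gradient u) m y))
        (x - y) := by
  have hle := mul_le_mul_of_nonneg_left
    (cutT_mul_norm_gDrift_sub_sq_le hu hd hr hconv hg hM hxy) (cutT_nonneg (r := r) (ρ := ‖y‖))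
  rw [norm_smul, Real.norm_of_nonneg cutT_nonneg, real_inner_smul_left]
  linarith

theorem cocoerciveOn_tamedDriftAt_sub_smul {u : E d → ℝ} (hu : Differentiable ℝ u) (hd : 0 < d)
    (hr : 0 < r) (hconv : StrongMonotone (gradient u) (m / 2))
    (hg : LipschitzOnWith K (gDrift (gradient u) m) (Metric.ball 0 r))
    (hM : OneSidedLipschitzOn M (tamedDriftAt (gradient u) m r) Set.univ) :
    CocoerciveOn (3 * (M - m)) (fun x ↦ tamedDriftAt (gradient u) m r x - m • x) Set.univ := by
  intro x _ y _
  wlog hxy : ‖x‖ ≤ ‖y‖ generalizing x y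
  · rw [← inner_neg_neg, neg_sub, neg_sub, norm_sub_rev]
    exact this y trivial x trivial (le_of_not_ge hxy)
  have hN : 0 ≤ M - m := tamingSup_nonneg.trans (tamingSup_le hd hr hM)
  rw [tamedDriftAt_sub_sub_smul]
  exact (norm_add_sq_le_mul_inner hN (mul_nonneg zero_le_two hN)
    (norm_sq_cutT_smul_gDrift_sub_le hu hd hr hconv hg hM hxy)
    (norm_sq_radialIncr_le hd hr hconv hg hM hxy)).trans_eq (by ring)

end Cocoercive

section OneStep

theorem exp_neg_le_quadratic {t : ℝ} (ht : 0 ≤ t) : Real.exp (-t) ≤ 1 - t + t ^ 2 / 2 := by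
  have hpos : 0 < 1 - t + t ^ 2 / 2 := by nlinarith [sq_nonneg (t - 1)]
  rw [Real.exp_neg, inv_le_comm₀ (Real.exp_pos t) hpos]
  refine le_trans ?_ (Real.quadratic_le_exp_of_nonneg ht)
  rw [inv_le_iff_one_le_mul₀ hpos]
  linarith [sq_nonneg (t ^ 2)]

theorem norm_le_of_norm_sq_le_mul_inner {V : Type*} [NormedAddCommGroup V] [InnerProductSpace ℝ V]
    {c : ℝ} (hc : 0 ≤ c) {p v : V} (h : ‖p‖ ^ 2 ≤ c * inner ℝ p v) : ‖p‖ ≤ c * ‖v‖ := by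
  rcases (norm_nonneg p).eq_or_lt' with hp | hp
  · rw [hp]
    positivity
  · refine le_of_mul_le_mul_right ?_ hp
    calc ‖p‖ * ‖p‖ = ‖p‖ ^ 2 := (sq _).symm
      _ ≤ c * (‖p‖ * ‖v‖) := h.trans (by gcongr; exact real_inner_le_norm p v)
      _ = c * ‖v‖ * ‖p‖ := by ring

theorem inner_eq_of_eq_add_smul_sub_smul {V : Type*} [NormedAddCommGroup V]
    [InnerProductSpace ℝ V] {a b : ℝ} {x w p y : V} (hy : y = x + a • w - b • p) (v : V) :
    inner ℝ y v = inner ℝ x v + a * inner ℝ w v - b * inner ℝ p v := by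
  rw [hy, inner_sub_left, inner_add_left, real_inner_smul_left, real_inner_smul_left]

/-- The parameters of one OBABO step in the unit of time in which the friction is `1`: the weight
`A = γ² / M` of the squared velocity, the strong monotonicity constant `μ = m / γ²`, the step size
`ε = lam γ` and the damping factor `η`. -/
structure UnitFrictionRegime (A μ ε η : ℝ) : Prop where
  four_le : 4 ≤ A
  mu_pos : 0 < μ
  mul_mu_le_one : A * μ ≤ 1
  eps_pos : 0 < ε
  eps_le_mu : 33 * ε ≤ μ
  eta_eq : η = Real.exp (-ε / 2)

namespace UnitFrictionRegime

variable {A μ ε η : ℝ} (h : UnitFrictionRegime A μ ε η)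

include h

theorem pos : 0 < A := four_pos.trans_le h.four_le

theorem mu_le : μ ≤ 1 / 4 := by
  linarith [h.mul_mu_le_one, mul_le_mul_of_nonneg_right h.four_le h.mu_pos.le]

theorem eps_le : ε ≤ 1 / 132 := by linarith [h.mu_le, h.eps_le_mu]

theorem eta_pos : 0 < η := h.eta_eq ▸ Real.exp_pos _

theorem eta_le_one : η ≤ 1 := by
  rw [h.eta_eq, Real.exp_le_one_iff]
  linarith [h.eps_pos]

theorem one_sub_le_eta : 1 - ε / 2 ≤ η := by
  rw [h.eta_eq]
  linarith [Real.add_one_le_exp (-ε / 2)]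

theorem eta_sq : η ^ 2 = Real.exp (-ε) := by
  rw [h.eta_eq, ← Real.exp_nat_mul]
  congr 1
  push_cast
  ring

theorem eta_pow_four_le : η ^ 4 ≤ 1 - 2 * ε + 2 * ε ^ 2 := by
  have hη : η ^ 4 = Real.exp (-(2 * ε)) := by
    rw [show η ^ 4 = (η ^ 2) ^ 2 by ring, h.eta_sq, ← Real.exp_nat_mul]
    congr 1
    push_cast
    ring
  rw [hη]
  exact (exp_neg_le_quadratic (mul_nonneg zero_le_two h.eps_pos.le)).trans_eq (by ring)

theorem abs_mul_eta_add_eta_sq_sub_one_le : |ε * η + η ^ 2 - 1| ≤ ε ^ 2 / 2 := by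
  have hε := h.eps_pos
  have hη : η ≤ 1 - ε / 2 + (ε / 2) ^ 2 / 2 := by
    rw [h.eta_eq, neg_div]
    exact exp_neg_le_quadratic (by positivity)
  have hlower : 1 - ε ≤ η ^ 2 := by
    rw [h.eta_sq]
    linarith [Real.add_one_le_exp (-ε)]
  have hupper : η ^ 2 ≤ 1 - ε + ε ^ 2 / 2 := h.eta_sq.trans_le (exp_neg_le_quadratic hε.le)
  have hcube : ε ^ 3 ≤ ε ^ 2 := pow_le_pow_of_le_one hε.le (by linarith [h.eps_le]) (by norm_num)
  rw [abs_le]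
  constructor
  · linarith [mul_le_mul_of_nonneg_left h.one_sub_le_eta hε.le]
  · linarith [mul_le_mul_of_nonneg_left hη hε.le, pow_pos hε 3]

theorem quadratic_form_nonpos {X W : ℝ} (hXW : 0 ≤ X * W) :
    (-(A / 2) + 2 - 3 / 2 * (A ^ 2 * μ) + A * μ / 3 + 2 * ε * A + 2 * ε) * W ^ 2 +
      (2 * A * μ + 2 * ε * μ + 3 * ε) * (X * W) +
      (-(5 / 3) * μ + ε * μ + 9 / 4 * ε + ε ^ 2 + ε ^ 2 * μ) * X ^ 2 ≤ 0 := by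
  have hε := h.eps_pos
  have hμ := h.mu_pos
  have hεμ : ε * μ ≤ 1 / 132 * μ := mul_le_mul_of_nonneg_right h.eps_le hμ.le
  have hεε : ε * ε ≤ 1 / 132 * ε := mul_le_mul_of_nonneg_right h.eps_le hε.le
  have hAμ : 4 * μ ≤ A * μ := mul_le_mul_of_nonneg_right h.four_le hμ.le
  have hAAμ : A * (4 * μ) ≤ A * (A * μ) := mul_le_mul_of_nonneg_left hAμ h.pos.le
  have hεA : A * (33 * ε) ≤ A * μ := mul_le_mul_of_nonneg_left h.eps_le_mu h.pos.le
  have hX : -(5 / 3) * μ + ε * μ + 9 / 4 * ε + ε ^ 2 + ε ^ 2 * μ ≤ -(3 / 2) * μ := by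
    have : ε * (ε * μ) ≤ 1 / 132 * (ε * μ) := mul_le_mul_of_nonneg_right h.eps_le (by positivity)
    linarith [h.eps_le_mu]
  have hcross : 2 * A * μ + 2 * ε * μ + 3 * ε ≤ 21 / 10 * (A * μ) := by
    linarith [h.eps_le_mu]
  have hW : -(A / 2) + 2 - 3 / 2 * (A ^ 2 * μ) + A * μ / 3 + 2 * ε * A + 2 * ε ≤
      -(5 / 4) * (A ^ 2 * μ) := by
    linarith [h.four_le, h.eps_le_mu]
  have hdisc : 0 ≤ μ * (X - 7 / 10 * A * W) ^ 2 := by positivity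
  have : 0 ≤ A ^ 2 * μ * W ^ 2 := by positivity
  have : 0 ≤ μ * X ^ 2 := by positivity
  linarith [mul_le_mul_of_nonneg_right hX (sq_nonneg X), mul_le_mul_of_nonneg_right hcross hXW,
    mul_le_mul_of_nonneg_right hW (sq_nonneg W)]

variable {V : Type*} [NormedAddCommGroup V] [InnerProductSpace ℝ V] {x w P y Q : V}

theorem mul_inner_le (x w : V) :
    (2 * (ε * η + η ^ 2 - 1) - 2 * A * μ * ε * η ^ 3 + 2 * (ε * μ / 3)) * inner ℝ x w ≤
      2 * A * μ * ε * (‖x‖ * ‖w‖) := by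
  have hε := h.eps_pos
  have hμ := h.mu_pos
  have hA := h.pos
  have hη := h.eta_pos
  have hcoeff :
      |2 * (ε * η + η ^ 2 - 1) - 2 * A * μ * ε * η ^ 3 + 2 * (ε * μ / 3)| ≤ 2 * A * μ * ε := by
    obtain ⟨hlower, hupper⟩ := abs_le.1 h.abs_mul_eta_add_eta_sq_sub_one_le
    have hη3 : 2 * A * μ * ε * η ^ 3 ≤ 2 * A * μ * ε :=
      mul_le_of_le_one_right (by positivity) (pow_le_one₀ hη.le h.eta_le_one)
    have : 0 ≤ 2 * A * μ * ε * η ^ 3 := by positivity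
    have hAεμ : 4 * (ε * μ) ≤ A * (ε * μ) :=
      mul_le_mul_of_nonneg_right h.four_le (by positivity)
    have hεε : ε * (33 * ε) ≤ ε * μ := mul_le_mul_of_nonneg_left h.eps_le_mu hε.le
    have : 0 < ε * μ := by positivity
    exact abs_le.2 ⟨by linarith, by linarith⟩
  refine (le_abs_self _).trans ?_
  rw [abs_mul]
  exact mul_le_mul hcoeff (abs_real_inner_le_norm x w) (abs_nonneg _) (by positivity)

theorem inv_sub_mu_nonneg : 0 ≤ A⁻¹ - μ := by
  have := h.mul_mu_le_one
  rw [sub_nonneg, ← one_div, le_div_iff₀' h.pos]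
  exact this

theorem inner_nonneg (hP : ‖P - μ • x‖ ^ 2 ≤ 3 * (A⁻¹ - μ) * inner ℝ (P - μ • x) x) :
    0 ≤ inner ℝ (P - μ • x) x :=
  inner_nonneg_of_norm_sq_le_mul_inner (mul_nonneg zero_le_three h.inv_sub_mu_nonneg) hP

theorem mul_norm_le (hP : ‖P - μ • x‖ ^ 2 ≤ 3 * (A⁻¹ - μ) * inner ℝ (P - μ • x) x) :
    A * ‖P‖ ≤ 3 * ‖x‖ := by
  have hF := norm_le_of_norm_sq_le_mul_inner (mul_nonneg zero_le_three h.inv_sub_mu_nonneg) hP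
  have hPF : ‖P‖ ≤ ‖P - μ • x‖ + μ * ‖x‖ := by
    refine (norm_le_norm_sub_add P (μ • x)).trans_eq ?_
    rw [norm_smul, Real.norm_of_nonneg h.mu_pos.le]
  have hAF := mul_le_mul_of_nonneg_left hF h.pos.le
  rw [← mul_assoc, mul_left_comm, mul_sub, mul_inv_cancel₀ h.pos.ne'] at hAF
  have : 0 ≤ A * μ * ‖x‖ := mul_nonneg (mul_nonneg h.pos.le h.mu_pos.le) (norm_nonneg x)
  linarith [mul_le_mul_of_nonneg_left hPF h.pos.le]

theorem norm_le (hP : ‖P - μ • x‖ ^ 2 ≤ 3 * (A⁻¹ - μ) * inner ℝ (P - μ • x) x) :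
    ‖P‖ ≤ ‖x‖ := by
  linarith [h.mul_norm_le hP, mul_le_mul_of_nonneg_right h.four_le (norm_nonneg P), norm_nonneg P]

theorem mul_norm_sq_le (hP : ‖P - μ • x‖ ^ 2 ≤ 3 * (A⁻¹ - μ) * inner ℝ (P - μ • x) x) :
    A * ‖P‖ ^ 2 ≤ 9 / 4 * ‖x‖ ^ 2 := by
  have hP' : ‖P‖ ≤ 3 / 4 * ‖x‖ := by
    linarith [h.mul_norm_le hP, mul_le_mul_of_nonneg_right h.four_le (norm_nonneg P)]
  calc A * ‖P‖ ^ 2 = A * ‖P‖ * ‖P‖ := by ring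
    _ ≤ 3 * ‖x‖ * (3 / 4 * ‖x‖) := mul_le_mul (h.mul_norm_le hP) hP' (by positivity) (by positivity)
    _ = 9 / 4 * ‖x‖ ^ 2 := by ring

theorem abs_mul_inner_le (hP : ‖P - μ • x‖ ^ 2 ≤ 3 * (A⁻¹ - μ) * inner ℝ (P - μ • x) x) (w : V) :
    |A * inner ℝ w (P - μ • x)| ≤
      3 / 4 * (A * (1 - A * μ)) * ‖w‖ ^ 2 + inner ℝ (P - μ • x) x := by
  have hA := h.pos
  have hc : 0 ≤ 1 - A * μ := sub_nonneg.2 h.mul_mu_le_one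
  set D := inner ℝ (P - μ • x) x
  have hD : 0 ≤ D := h.inner_nonneg hP
  refine abs_le_of_sq_le_sq ?_ (by positivity)
  calc (A * inner ℝ w (P - μ • x)) ^ 2
      ≤ A ^ 2 * (‖w‖ ^ 2 * ‖P - μ • x‖ ^ 2) := by
        rw [mul_pow, ← mul_pow ‖w‖]
        exact mul_le_mul_of_nonneg_left (sq_le_sq.2 ((abs_real_inner_le_norm _ _).trans
          (le_abs_self _))) (sq_nonneg A)
    _ ≤ A ^ 2 * (‖w‖ ^ 2 * (3 * (A⁻¹ - μ) * D)) := by gcongr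
    _ = 4 * (3 / 4 * (A * (1 - A * μ)) * ‖w‖ ^ 2) * D := by field_simp
    _ ≤ (3 / 4 * (A * (1 - A * μ)) * ‖w‖ ^ 2 + D) ^ 2 := four_mul_le_sq_add _ _

theorem neg_mul_inner_le (hP : ‖P - μ • x‖ ^ 2 ≤ 3 * (A⁻¹ - μ) * inner ℝ (P - μ • x) x) (w : V) :
    -(A * ε * η ^ 3 * inner ℝ w (P - μ • x)) ≤
      3 / 4 * ε * (A * (1 - A * μ)) * ‖w‖ ^ 2 + ε * η * inner ℝ (P - μ • x) x := by
  have hη := h.eta_pos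
  have hη3 : η ^ 3 ≤ η := pow_le_of_le_one hη.le h.eta_le_one three_ne_zero
  have hS : 0 ≤ 3 / 4 * (A * (1 - A * μ)) * ‖w‖ ^ 2 := by
    have := sub_nonneg.2 h.mul_mu_le_one
    have := h.pos
    positivity
  have hε := h.eps_pos
  calc -(A * ε * η ^ 3 * inner ℝ w (P - μ • x))
      = ε * η ^ 3 * -(A * inner ℝ w (P - μ • x)) := by ring
    _ ≤ ε * η * |A * inner ℝ w (P - μ • x)| := by
        refine mul_le_mul_of_nonneg_left (neg_le_abs _) (by positivity) |>.trans ?_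
        gcongr
    _ ≤ ε * η * (3 / 4 * (A * (1 - A * μ)) * ‖w‖ ^ 2 + inner ℝ (P - μ • x) x) := by
        gcongr
        exact h.abs_mul_inner_le hP w
    _ ≤ 3 / 4 * ε * (A * (1 - A * μ)) * ‖w‖ ^ 2 + ε * η * inner ℝ (P - μ • x) x := by
        linarith [mul_le_mul_of_nonneg_left (mul_le_of_le_one_left hS h.eta_le_one) hε.le]

theorem norm_sq_position_le (hP : ‖P - μ • x‖ ^ 2 ≤ 3 * (A⁻¹ - μ) * inner ℝ (P - μ • x) x)
    (hy : y = x + (ε * η) • w - (ε ^ 2 / 2) • P) :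
    ‖y‖ ^ 2 ≤
      ‖x‖ ^ 2 + 2 * ε * η * inner ℝ x w + 2 * ε ^ 2 * ‖w‖ ^ 2 + ε ^ 4 / 2 * ‖x‖ ^ 2 := by
  have hε := h.eps_pos
  have hη := h.eta_pos
  have hxP : 0 ≤ inner ℝ x P := by
    have hD := h.inner_nonneg hP
    rw [inner_sub_left, real_inner_smul_left, real_inner_self_eq_norm_sq, sub_nonneg] at hD
    rw [real_inner_comm]
    exact hD.trans' (mul_nonneg h.mu_pos.le (sq_nonneg _))
  have hincr : ‖(ε * η) • w - (ε ^ 2 / 2) • P‖ ^ 2 ≤ 2 * ε ^ 2 * ‖w‖ ^ 2 + ε ^ 4 / 2 * ‖x‖ ^ 2 :=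
    calc ‖(ε * η) • w - (ε ^ 2 / 2) • P‖ ^ 2
        ≤ (ε * ‖w‖ + ε ^ 2 / 2 * ‖x‖) ^ 2 := by
          gcongr
          refine norm_sub_le_of_le ?_ ?_
          · rw [norm_smul, Real.norm_of_nonneg (by positivity)]
            gcongr
            exact mul_le_of_le_one_right hε.le h.eta_le_one
          · rw [norm_smul, Real.norm_of_nonneg (by positivity)]
            gcongr
            exact h.norm_le hP
      _ ≤ 2 * ((ε * ‖w‖) ^ 2 + (ε ^ 2 / 2 * ‖x‖) ^ 2) := add_sq_le
      _ = 2 * ε ^ 2 * ‖w‖ ^ 2 + ε ^ 4 / 2 * ‖x‖ ^ 2 := by ring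
  rw [hy, add_sub_assoc, norm_add_sq_real, inner_sub_right, real_inner_smul_right,
    real_inner_smul_right]
  linarith [mul_nonneg (sq_nonneg ε) hxP]

theorem le_norm_sq_position (hP : ‖P - μ • x‖ ^ 2 ≤ 3 * (A⁻¹ - μ) * inner ℝ (P - μ • x) x)
    (hy : y = x + (ε * η) • w - (ε ^ 2 / 2) • P) :
    ‖x‖ ^ 2 - 2 * ε * (‖x‖ * ‖w‖) - ε ^ 2 * ‖x‖ ^ 2 ≤ ‖y‖ ^ 2 := by
  have hε := h.eps_pos
  have hxw : |ε * η * inner ℝ x w| ≤ ε * (‖x‖ * ‖w‖) := by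
    rw [abs_mul, abs_of_pos (mul_pos hε h.eta_pos)]
    exact mul_le_mul (mul_le_of_le_one_right hε.le h.eta_le_one) (abs_real_inner_le_norm x w)
      (abs_nonneg _) hε.le
  have hxP : inner ℝ x P ≤ ‖x‖ ^ 2 := by
    rw [sq]
    exact (real_inner_le_norm x P).trans (by gcongr; exact h.norm_le hP)
  rw [hy, add_sub_assoc, norm_add_sq_real, inner_sub_right, real_inner_smul_right,
    real_inner_smul_right]
  linarith [mul_le_mul_of_nonneg_left hxP (sq_nonneg ε), (abs_le.1 hxw).1,
    sq_nonneg ‖(ε * η) • w - (ε ^ 2 / 2) • P‖]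

theorem two_mul_inner_position_velocity_le
    (hP : ‖P - μ • x‖ ^ 2 ≤ 3 * (A⁻¹ - μ) * inner ℝ (P - μ • x) x)
    (hy : y = x + (ε * η) • w - (ε ^ 2 / 2) • P) :
    2 * inner ℝ y (η ^ 2 • w - (ε * η / 2) • (P + Q)) ≤
      2 * η ^ 2 * inner ℝ x w + 2 * ε * ‖w‖ ^ 2 + 2 * ε ^ 2 * (‖x‖ * ‖w‖) + ε ^ 3 / 2 * ‖x‖ ^ 2 -
        ε * η * (inner ℝ P x + inner ℝ Q y) := by
  have hε := h.eps_pos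
  have hη := h.eta_pos
  have hwP : |2 * ε ^ 2 * η ^ 2 * inner ℝ w P| ≤ 2 * ε ^ 2 * (‖x‖ * ‖w‖) := by
    rw [abs_mul, abs_of_pos (by positivity), mul_comm ‖x‖]
    refine mul_le_mul ?_ ((abs_real_inner_le_norm w P).trans ?_) (abs_nonneg _) (by positivity)
    · exact mul_le_of_le_one_right (by positivity) (pow_le_one₀ hη.le h.eta_le_one)
    · exact mul_le_mul_of_nonneg_left (h.norm_le hP) (norm_nonneg w)
  have hww : η ^ 3 * (2 * ε * ‖w‖ ^ 2) ≤ 2 * ε * ‖w‖ ^ 2 :=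
    mul_le_of_le_one_left (by positivity) (pow_le_one₀ hη.le h.eta_le_one)
  have hPP : η * (ε ^ 3 / 2 * ‖P‖ ^ 2) ≤ ε ^ 3 / 2 * ‖x‖ ^ 2 := by
    refine (mul_le_of_le_one_left (by positivity) h.eta_le_one).trans ?_
    gcongr
    exact h.norm_le hP
  rw [inner_sub_right, real_inner_smul_right, real_inner_smul_right, inner_add_right,
    real_inner_comm y Q, inner_eq_of_eq_add_smul_sub_smul hy w,
    inner_eq_of_eq_add_smul_sub_smul hy P, real_inner_comm x P,
    real_inner_comm w P, real_inner_self_eq_norm_sq, real_inner_self_eq_norm_sq]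
  linarith [(abs_le.1 hwP).1]

theorem neg_mul_inner_position_le
    (hP : ‖P - μ • x‖ ^ 2 ≤ 3 * (A⁻¹ - μ) * inner ℝ (P - μ • x) x)
    (hy : y = x + (ε * η) • w - (ε ^ 2 / 2) • P) :
    -(A * μ * ε * η ^ 3 * inner ℝ w y) ≤
      -(A * μ * ε * η ^ 3 * inner ℝ x w) + ε ^ 3 / 2 * (‖x‖ * ‖w‖) := by
  have hε := h.eps_pos
  have hη := h.eta_pos
  have hA := h.pos
  have hμ := h.mu_pos
  have hwP : A * μ * η ^ 3 * (ε ^ 3 / 2 * inner ℝ P w) ≤ 1 * (ε ^ 3 / 2 * (‖x‖ * ‖w‖)) := by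
    have hcoeff : A * μ * η ^ 3 ≤ 1 :=
      mul_le_one₀ h.mul_mu_le_one (by positivity) (pow_le_one₀ hη.le h.eta_le_one)
    have hPw : inner ℝ P w ≤ ‖x‖ * ‖w‖ :=
      (real_inner_le_norm P w).trans (by gcongr; exact h.norm_le hP)
    exact (mul_le_mul_of_nonneg_left (by gcongr) (by positivity)).trans
      (mul_le_mul_of_nonneg_right hcoeff (by positivity))
  have : 0 ≤ A * μ * ε * η ^ 3 * (ε * η * ‖w‖ ^ 2) := by positivity
  rw [real_inner_comm, inner_eq_of_eq_add_smul_sub_smul hy, real_inner_self_eq_norm_sq]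
  linarith

theorem mul_norm_add_sq_le
    (hP : ‖P - μ • x‖ ^ 2 ≤ 3 * (A⁻¹ - μ) * inner ℝ (P - μ • x) x)
    (hQ : ‖Q - μ • y‖ ^ 2 ≤ 3 * (A⁻¹ - μ) * inner ℝ (Q - μ • y) y) :
    A * ‖P + Q‖ ^ 2 ≤ 9 / 2 * (‖x‖ ^ 2 + ‖y‖ ^ 2) := by
  have hA := h.pos
  calc A * ‖P + Q‖ ^ 2 ≤ A * (2 * (‖P‖ ^ 2 + ‖Q‖ ^ 2)) := by
        gcongr
        exact (pow_le_pow_left₀ (norm_nonneg _) (norm_add_le P Q) 2).trans add_sq_le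
    _ ≤ 9 / 2 * (‖x‖ ^ 2 + ‖y‖ ^ 2) := by linarith [h.mul_norm_sq_le hP, h.mul_norm_sq_le hQ]

theorem mul_norm_sq_velocity_le
    (hP : ‖P - μ • x‖ ^ 2 ≤ 3 * (A⁻¹ - μ) * inner ℝ (P - μ • x) x)
    (hQ : ‖Q - μ • y‖ ^ 2 ≤ 3 * (A⁻¹ - μ) * inner ℝ (Q - μ • y) y)
    (hy : y = x + (ε * η) • w - (ε ^ 2 / 2) • P) :
    A * ‖η ^ 2 • w - (ε * η / 2) • (P + Q)‖ ^ 2 ≤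
      A * (1 - 2 * ε + 2 * ε ^ 2) * ‖w‖ ^ 2 - 2 * A * μ * ε * η ^ 3 * inner ℝ x w +
        3 / 2 * ε * (A * (1 - A * μ)) * ‖w‖ ^ 2 +
        ε * η * (inner ℝ (P - μ • x) x + inner ℝ (Q - μ • y) y) +
        ε ^ 3 / 2 * (‖x‖ * ‖w‖) + 9 / 8 * ε ^ 2 * (‖x‖ ^ 2 + ‖y‖ ^ 2) := by
  have hA := h.pos
  have hww : A * η ^ 4 * ‖w‖ ^ 2 ≤ A * (1 - 2 * ε + 2 * ε ^ 2) * ‖w‖ ^ 2 := by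
    gcongr
    exact h.eta_pow_four_le
  have hPQ : η ^ 2 * (ε ^ 2 / 4 * (A * ‖P + Q‖ ^ 2)) ≤ 9 / 8 * ε ^ 2 * (‖x‖ ^ 2 + ‖y‖ ^ 2) := by
    have := mul_le_mul_of_nonneg_left (h.mul_norm_add_sq_le hP hQ) (sq_nonneg ε)
    refine (mul_le_of_le_one_left (by positivity) ?_).trans (by linarith)
    exact pow_le_one₀ h.eta_pos.le h.eta_le_one
  have hexpand : ‖η ^ 2 • w - (ε * η / 2) • (P + Q)‖ ^ 2 =
      η ^ 4 * ‖w‖ ^ 2 - ε * η ^ 3 * inner ℝ w (P + Q) + ε ^ 2 * η ^ 2 / 4 * ‖P + Q‖ ^ 2 := by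
    simp only [norm_sub_sq_real, real_inner_smul_left, real_inner_smul_right, norm_smul,
      Real.norm_eq_abs, mul_pow, sq_abs]
    ring
  have hsplit : inner ℝ w (P + Q) = inner ℝ w (P - μ • x) + inner ℝ w (Q - μ • y) +
      μ * inner ℝ x w + μ * inner ℝ w y := by
    simp only [inner_sub_right, inner_add_right, real_inner_smul_right, real_inner_comm w x]
    ring
  rw [hexpand, hsplit]
  linarith [h.neg_mul_inner_le hP w, h.neg_mul_inner_le hQ w, h.neg_mul_inner_position_le hP hy]

theorem position_potential_le
    (hP : ‖P - μ • x‖ ^ 2 ≤ 3 * (A⁻¹ - μ) * inner ℝ (P - μ • x) x)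
    (hy : y = x + (ε * η) • w - (ε ^ 2 / 2) • P) :
    -(ε * η * μ * (‖x‖ ^ 2 + ‖y‖ ^ 2)) + 9 / 8 * ε ^ 2 * (‖x‖ ^ 2 + ‖y‖ ^ 2) ≤
      (-(2 * ε * μ) + ε ^ 2 * μ + 9 / 4 * ε ^ 2 + ε ^ 3 * μ) * ‖x‖ ^ 2 +
        2 * ε ^ 2 * μ * (‖x‖ * ‖w‖) := by
  have hε := h.eps_pos
  have hμ := h.mu_pos
  have hημ : ε * μ - ε ^ 2 * μ / 2 ≤ ε * η * μ := by
    linarith [mul_le_mul_of_nonneg_left h.one_sub_le_eta (by positivity : 0 ≤ ε * μ)]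
  set c := ε * η * μ - 9 / 8 * ε ^ 2 with hc
  have hcoeff : 0 ≤ c := by
    nlinarith [mul_le_mul_of_nonneg_left h.eps_le_mu hε.le, h.eps_le]
  have hcε : c ≤ ε * μ := by
    have : ε * η * μ ≤ ε * μ := by
      rw [mul_right_comm]
      exact mul_le_of_le_one_right (by positivity) h.eta_le_one
    linarith [sq_nonneg ε]
  have hY := mul_le_mul_of_nonneg_left (h.le_norm_sq_position hP hy) hcoeff
  have hrest := mul_le_mul_of_nonneg_right hcε
    (by positivity : 0 ≤ 2 * ε * (‖x‖ * ‖w‖) + ε ^ 2 * ‖x‖ ^ 2)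
  have hX := mul_le_mul_of_nonneg_right hημ (sq_nonneg ‖x‖)
  rw [hc] at hY hrest
  linarith

theorem contraction
    (hP : ‖P - μ • x‖ ^ 2 ≤ 3 * (A⁻¹ - μ) * inner ℝ (P - μ • x) x)
    (hQ : ‖Q - μ • y‖ ^ 2 ≤ 3 * (A⁻¹ - μ) * inner ℝ (Q - μ • y) y)
    (hy : y = x + (ε * η) • w - (ε ^ 2 / 2) • P) {w₁ : V}
    (hw₁ : w₁ = η ^ 2 • w - (ε * η / 2) • (P + Q)) :
    ‖y‖ ^ 2 + 2 * inner ℝ y w₁ + A * ‖w₁‖ ^ 2 ≤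
      (1 - ε * μ / 3) * (‖x‖ ^ 2 + 2 * inner ℝ x w + A * ‖w‖ ^ 2) := by
  have hε := h.eps_pos
  have inner_add_smul (p v : V) : inner ℝ p v = inner ℝ (p - μ • v) v + μ * ‖v‖ ^ 2 := by
    rw [inner_sub_left, real_inner_smul_left, real_inner_self_eq_norm_sq, sub_add_cancel]
  have hyw := h.two_mul_inner_position_velocity_le (Q := Q) hP hy
  rw [← hw₁, inner_add_smul P x, inner_add_smul Q y] at hyw
  have hww := h.mul_norm_sq_velocity_le hP hQ hy
  rw [← hw₁] at hww
  have hform := mul_le_mul_of_nonneg_left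
    (h.quadratic_form_nonpos (mul_nonneg (norm_nonneg x) (norm_nonneg w))) hε.le
  have hcube : ε ^ 3 / 2 ≤ ε ^ 2 :=
    (half_le_self (by positivity)).trans
      (pow_le_pow_of_le_one hε.le (by linarith [h.eps_le]) (by norm_num))
  have hfour : ε ^ 4 ≤ ε ^ 3 := pow_le_pow_of_le_one hε.le (by linarith [h.eps_le]) (by norm_num)
  linarith [h.norm_sq_position_le hP hy, h.position_potential_le hP hy, h.mul_inner_le x w,
    mul_le_mul_of_nonneg_right hcube (mul_nonneg (norm_nonneg x) (norm_nonneg w)),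
    mul_le_mul_of_nonneg_right hfour (sq_nonneg ‖x‖)]

end UnitFrictionRegime

end OneStep

section WeightedNorm

variable {d : ℕ} {a b : ℝ}

theorem two_mul_abs_mul_inner_le (hab : 4 * b ^ 2 ≤ a) (z : Phase d) :
    |2 * b * inner ℝ z.1 z.2| ≤ (‖z.1‖ ^ 2 + a * ‖z.2‖ ^ 2) / 2 := by
  rw [abs_mul, abs_mul, abs_two]
  have hinner := mul_le_mul_of_nonneg_left (abs_real_inner_le_norm z.1 z.2) (abs_nonneg b)
  have hyoung := sq_nonneg (‖z.1‖ - 2 * |b| * ‖z.2‖)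
  have hb := mul_le_mul_of_nonneg_right hab (sq_nonneg ‖z.2‖)
  rw [← sq_abs b] at hb
  linarith

theorem weightedNorm_sq (hab : 4 * b ^ 2 ≤ a) (z : Phase d) :
    weightedNorm a b z ^ 2 = ‖z.1‖ ^ 2 + 2 * b * inner ℝ z.1 z.2 + a * ‖z.2‖ ^ 2 := by
  have ha : 0 ≤ a := hab.trans' (by positivity)
  have : 0 ≤ a * ‖z.2‖ ^ 2 := by positivity
  refine Real.sq_sqrt ?_
  linarith [(abs_le.1 (two_mul_abs_mul_inner_le hab z)).1, sq_nonneg ‖z.1‖]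

theorem euclNorm_sq (z : Phase d) : euclNorm z ^ 2 = ‖z.1‖ ^ 2 + ‖z.2‖ ^ 2 :=
  Real.sq_sqrt (by positivity)

theorem weightedNorm_sq_le_euclNorm_sq (hab : 4 * b ^ 2 ≤ a) (z : Phase d) :
    weightedNorm a b z ^ 2 ≤ 3 / 2 * max 1 a * euclNorm z ^ 2 := by
  rw [weightedNorm_sq hab, euclNorm_sq]
  linarith [(abs_le.1 (two_mul_abs_mul_inner_le hab z)).2,
    mul_le_mul_of_nonneg_right (le_max_left 1 a) (sq_nonneg ‖z.1‖),
    mul_le_mul_of_nonneg_right (le_max_right 1 a) (sq_nonneg ‖z.2‖)]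

theorem min_mul_euclNorm_sq_le (hab : 4 * b ^ 2 ≤ a) (z : Phase d) :
    min 1 a * euclNorm z ^ 2 ≤ 2 * weightedNorm a b z ^ 2 := by
  rw [weightedNorm_sq hab, euclNorm_sq]
  linarith [(abs_le.1 (two_mul_abs_mul_inner_le hab z)).1,
    mul_le_mul_of_nonneg_right (min_le_left 1 a) (sq_nonneg ‖z.1‖),
    mul_le_mul_of_nonneg_right (min_le_right 1 a) (sq_nonneg ‖z.2‖)]

theorem continuous_weightedNorm (a b : ℝ) : Continuous (weightedNorm a b : Phase d → ℝ) := by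
  unfold weightedNorm
  fun_prop

theorem norm_le_euclNorm (z : Phase d) : ‖z‖ ≤ euclNorm z :=
  max_le (Real.le_sqrt_of_sq_le (le_add_of_nonneg_right (sq_nonneg _)))
    (Real.le_sqrt_of_sq_le (le_add_of_nonneg_left (sq_nonneg _)))

theorem euclNorm_sq_le_two_mul_norm_sq (z : Phase d) : euclNorm z ^ 2 ≤ 2 * ‖z‖ ^ 2 := by
  rw [euclNorm_sq, two_mul]
  exact add_le_add (pow_le_pow_left₀ (norm_nonneg _) (norm_fst_le z) 2)
    (pow_le_pow_left₀ (norm_nonneg _) (norm_snd_le z) 2)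

end WeightedNorm

section Contraction

theorem four_mul_le_sq {M γ : ℝ} (hM : 0 ≤ M) (hγM : 2 * √M ≤ γ) : 4 * M ≤ γ ^ 2 := by
  calc 4 * M = (2 * √M) ^ 2 := by rw [mul_pow, Real.sq_sqrt hM]; norm_num
    _ ≤ γ ^ 2 := by gcongr

theorem four_mul_one_div_sq_le {M γ : ℝ} (hM : 0 < M) (hγ : 0 < γ) (hγM : 2 * √M ≤ γ) :
    4 * (1 / γ) ^ 2 ≤ 1 / M := by
  rw [one_div_pow, mul_one_div, div_le_div_iff₀ (by positivity) hM, one_mul]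
  exact four_mul_le_sq hM.le hγM

theorem unitFrictionRegime {m M lam γ : ℝ} (hm : 0 < m) (hmM : m ≤ M) (hlam : 0 < lam)
    (hγ : 0 < γ) (hγM : 2 * √M ≤ γ) (hlamγ : lam ≤ m / (33 * γ ^ 3)) :
    UnitFrictionRegime (γ ^ 2 / M) (m / γ ^ 2) (lam * γ) (eta lam γ) where
  four_le := by
    rw [le_div_iff₀ (hm.trans_le hmM)]
    exact four_mul_le_sq (hm.trans_le hmM).le hγM
  mu_pos := by positivity
  mul_mu_le_one := by
    have : γ ^ 2 / M * (m / γ ^ 2) = m / M := by field_simp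
    rw [this]
    exact div_le_one_of_le₀ hmM (hm.trans_le hmM).le
  eps_pos := by positivity
  eps_le_mu := by
    rw [le_div_iff₀ (by positivity)] at hlamγ ⊢
    linarith
  eta_eq := rfl

variable {d : ℕ} {f : E d → E d} {m M lam γ : ℝ}

theorem weightedNorm_one_div_sq (hM : 0 < M) (hγ : 0 < γ) (hγM : 2 * √M ≤ γ) (z : Phase d) :
    weightedNorm (1 / M) (1 / γ) z ^ 2 =
      ‖z.1‖ ^ 2 + 2 * inner ℝ z.1 (γ⁻¹ • z.2) + γ ^ 2 / M * ‖γ⁻¹ • z.2‖ ^ 2 := by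
  rw [weightedNorm_sq (four_mul_one_div_sq_le hM hγ hγM), norm_smul, real_inner_smul_right, mul_pow,
    Real.norm_eq_abs, sq_abs]
  field_simp

theorem CocoerciveOn.norm_smul_sub_sq_le (hγ : 0 < γ)
    (hf : CocoerciveOn (3 * (M - m)) (fun x ↦ f x - m • x) Set.univ) (x y : E d) :
    ‖(γ ^ 2)⁻¹ • (f x - f y) - (m / γ ^ 2) • (x - y)‖ ^ 2 ≤
      3 * ((γ ^ 2 / M)⁻¹ - m / γ ^ 2) *
        inner ℝ ((γ ^ 2)⁻¹ • (f x - f y) - (m / γ ^ 2) • (x - y)) (x - y) := by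
  have hsmul : (γ ^ 2)⁻¹ • (f x - f y) - (m / γ ^ 2) • (x - y) =
      (γ ^ 2)⁻¹ • ((f x - m • x) - (f y - m • y)) := by
    rw [div_eq_inv_mul]
    module
  rw [hsmul, norm_smul, mul_pow, real_inner_smul_left, Real.norm_eq_abs, sq_abs]
  refine (mul_le_mul_of_nonneg_left (hf x trivial y trivial) (sq_nonneg _)).trans_eq ?_
  field_simp

theorem obaboPos_sub (f : E d → E d) (hγ : γ ≠ 0) (z z' : Phase d) (G : E d) :
    obaboPos f lam γ z.1 z.2 G - obaboPos f lam γ z'.1 z'.2 G =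
      z.1 - z'.1 + (lam * γ * eta lam γ) • γ⁻¹ • (z.2 - z'.2) -
        ((lam * γ) ^ 2 / 2) • (γ ^ 2)⁻¹ • (f z.1 - f z'.1) := by
  have hvel : lam * γ * eta lam γ * γ⁻¹ = lam * eta lam γ := by field_simp
  have hforce : (lam * γ) ^ 2 / 2 * (γ ^ 2)⁻¹ = lam ^ 2 / 2 := by field_simp
  rw [smul_smul, smul_smul, hvel, hforce]
  unfold obaboPos
  module

theorem smul_obaboStep_snd_sub (f : E d → E d) (hγ : γ ≠ 0) (z z' : Phase d) (G : E d × E d) :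
    γ⁻¹ • ((obaboStep f lam γ (z, G)).2 - (obaboStep f lam γ (z', G)).2) =
      eta lam γ ^ 2 • γ⁻¹ • (z.2 - z'.2) - (lam * γ * eta lam γ / 2) •
        ((γ ^ 2)⁻¹ • (f z.1 - f z'.1) + (γ ^ 2)⁻¹ •
          (f (obaboPos f lam γ z.1 z.2 G.1) - f (obaboPos f lam γ z'.1 z'.2 G.1))) := by
  have hforce : lam * γ * eta lam γ / 2 * (γ ^ 2)⁻¹ = γ⁻¹ * (lam * eta lam γ / 2) := by field_simp
  rw [← smul_add, smul_smul (lam * γ * eta lam γ / 2), hforce]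
  simp only [obaboStep]
  module

theorem weightedNorm_obaboStep_sub_sq_le (hm : 0 < m) (hmM : m ≤ M) (hlam : 0 < lam) (hγ : 0 < γ)
    (hγM : 2 * √M ≤ γ) (hlamγ : lam ≤ m / (33 * γ ^ 3))
    (hf : CocoerciveOn (3 * (M - m)) (fun x ↦ f x - m • x) Set.univ)
    (z z' : Phase d) (G : E d × E d) :
    weightedNorm (1 / M) (1 / γ) (obaboStep f lam γ (z, G) - obaboStep f lam γ (z', G)) ^ 2 ≤
      (1 - lam * (m / (3 * γ))) * weightedNorm (1 / M) (1 / γ) (z - z') ^ 2 := by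
  have hM : 0 < M := hm.trans_le hmM
  have hrate : lam * γ * (m / γ ^ 2) / 3 = lam * (m / (3 * γ)) := by field_simp
  rw [weightedNorm_one_div_sq hM hγ hγM, weightedNorm_one_div_sq hM hγ hγM, ← hrate]
  exact (unitFrictionRegime hm hmM hlam hγ hγM hlamγ).contraction
    (hf.norm_smul_sub_sq_le hγ _ _) (hf.norm_smul_sub_sq_le hγ _ _)
    (obaboPos_sub f hγ.ne' z z' G.1) (smul_obaboStep_snd_sub f hγ.ne' z z' G)

theorem one_sub_mul_mem_Ioo (hm : 0 < m) (hmM : m ≤ M) (hlam : 0 < lam)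
    (hγ : 0 < γ) (hγM : 2 * √M ≤ γ) (hlamγ : lam ≤ m / (33 * γ ^ 3)) :
    1 - lam * (m / (3 * γ)) ∈ Set.Ioo 0 1 := by
  have hreg := unitFrictionRegime hm hmM hlam hγ hγM hlamγ
  have hrate : lam * (m / (3 * γ)) = lam * γ * (m / γ ^ 2) / 3 := by field_simp
  have := mul_le_mul hreg.eps_le hreg.mu_le hreg.mu_pos.le (by norm_num)
  have := mul_pos hreg.eps_pos hreg.mu_pos
  rw [hrate]
  constructor <;> linarith

theorem CocoerciveOn.exists_lipschitzWith {c : ℝ} (hc : 0 ≤ c)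
    (hf : CocoerciveOn c (fun x ↦ f x - m • x) Set.univ) : ∃ K, LipschitzWith K f := by
  have hlip : LipschitzWith c.toNNReal fun x ↦ f x - m • x := .of_dist_le' fun x y ↦ by
    rw [dist_eq_norm, dist_eq_norm]
    exact norm_le_of_norm_sq_le_mul_inner hc (hf x trivial y trivial)
  exact ⟨_, by simpa only [sub_add_cancel] using hlip.add (lipschitzWith_smul m)⟩

end Contraction

section RandomMapKernel

variable {X Ω : Type*} [MeasurableSpace X] [MeasurableSpace Ω]

/-- The Markov kernel `x ↦ law of F (x, ξ)`, with `ξ` of law `μ`, of the chain that applies at each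
step the random map `F (·, ξ)` with a fresh input `ξ`. For a measurable `F` only: otherwise it is
the junk value `0` of `Kernel.map`. -/
noncomputable def randomMapKernel (F : X × Ω → X) (μ : Measure Ω) : Kernel X X :=
  (Kernel.id ×ₖ Kernel.const X μ).map F

variable {F : X × Ω → X} {μ : Measure Ω}

theorem bind_randomMapKernel [SFinite μ] (hF : Measurable F) (ν : Measure X) [SFinite ν] :
    ν.bind (randomMapKernel F μ) = (ν.prod μ).map F := by
  rw [randomMapKernel, ← Measure.map_comp ν _ hF, ← Measure.compProd_eq_comp_prod,
    Measure.compProd_const]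

theorem isProbabilityMeasure_bind_randomMapKernel [IsProbabilityMeasure μ] (hF : Measurable F)
    (ν : Measure X) [IsProbabilityMeasure ν] :
    IsProbabilityMeasure (ν.bind (randomMapKernel F μ)) := by
  rw [bind_randomMapKernel hF]
  exact Measure.isProbabilityMeasure_map hF.aemeasurable

end RandomMapKernel

section Wasserstein

variable {d : ℕ} {Ω : Type*} [MeasurableSpace Ω] {N N' : Phase d → ℝ} {p : ℝ}

theorem lintegral_ofReal_rpow_le_of_le_mul {α : Type*} [MeasurableSpace α] {ρ : Measure α}
    {f g : α → ℝ} {k : ℝ} (hk : 0 ≤ k) (hp : 0 ≤ p) (h : ∀ a, f a ≤ k * g a) :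
    ∫⁻ a, ENNReal.ofReal (f a) ^ p ∂ρ ≤
      ENNReal.ofReal k ^ p * ∫⁻ a, ENNReal.ofReal (g a) ^ p ∂ρ := by
  rw [← lintegral_const_mul' _ _ (ENNReal.rpow_ne_top_of_nonneg hp ENNReal.ofReal_ne_top)]
  refine lintegral_mono fun a ↦ ?_
  rw [← ENNReal.mul_rpow_of_nonneg _ _ hp, ← ENNReal.ofReal_mul hk]
  exact ENNReal.rpow_le_rpow (ENNReal.ofReal_le_ofReal (h a)) hp

theorem wass_le_mul_of_forall_couplings {k : ℝ} (hk : 0 < k) (hp : 0 < p)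
    {μ ν μ' ν' : Measure (Phase d)}
    (h : ∀ ρ ∈ couplings μ ν, ∃ ρ' ∈ couplings μ' ν',
      ∫⁻ w, ENNReal.ofReal (N' (w.1 - w.2)) ^ p ∂ρ' ≤
        ENNReal.ofReal k ^ p * ∫⁻ w, ENNReal.ofReal (N (w.1 - w.2)) ^ p ∂ρ) :
    wass N' p μ' ν' ≤ ENNReal.ofReal k * wass N p μ ν := by
  have hk0 : ENNReal.ofReal k ^ p ≠ 0 := by simp [hk]
  have hktop : ENNReal.ofReal k ^ p ≠ ⊤ := ENNReal.rpow_ne_top_of_nonneg hp.le ENNReal.ofReal_ne_top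
  unfold wass
  rw [← ENNReal.rpow_rpow_inv hp.ne' (ENNReal.ofReal k), ← one_div,
    ← ENNReal.mul_rpow_of_nonneg _ _ (by positivity)]
  refine ENNReal.rpow_le_rpow ?_ (by positivity)
  simp only [ENNReal.mul_iInf_of_ne hk0 hktop]
  refine le_iInf₂ fun ρ hρ ↦ ?_
  obtain ⟨ρ', hρ', hle⟩ := h ρ hρ
  exact (iInf₂_le ρ' hρ').trans hle

theorem wass_le_of_norm_le {k : ℝ} (hk : 0 < k) (hp : 0 < p) (h : ∀ z, N' z ≤ k * N z)
    (μ ν : Measure (Phase d)) : wass N' p μ ν ≤ ENNReal.ofReal k * wass N p μ ν :=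
  wass_le_mul_of_forall_couplings hk hp fun ρ hρ ↦
    ⟨ρ, hρ, lintegral_ofReal_rpow_le_of_le_mul hk.le hp.le fun _ ↦ h _⟩

variable {F : Phase d × Ω → Phase d} {μ : Measure Ω}

/-- The synchronous coupling: if `ρ` couples `ν` and `ν'`, moving both components by the same random
map `F (·, ξ)` couples the laws one step later. -/
noncomputable def synchronousCoupling (F : Phase d × Ω → Phase d) (μ : Measure Ω)
    (ρ : Measure (Phase d × Phase d)) : Measure (Phase d × Phase d) :=
  (ρ.prod μ).map fun w ↦ (F (w.1.1, w.2), F (w.1.2, w.2))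

theorem synchronousCoupling_mem_couplings [SFinite μ] (hF : Measurable F)
    (ρ : Measure (Phase d × Phase d)) [SFinite ρ] :
    synchronousCoupling F μ ρ ∈ couplings ((ρ.map Prod.fst).bind (randomMapKernel F μ))
      ((ρ.map Prod.snd).bind (randomMapKernel F μ)) := by
  have hpair : Measurable fun w : (Phase d × Phase d) × Ω ↦ (F (w.1.1, w.2), F (w.1.2, w.2)) := by
    fun_prop
  have hmarginal {φ : Phase d × Phase d → Phase d} (hφ : Measurable φ) :
      (ρ.map φ).bind (randomMapKernel F μ) = (ρ.prod μ).map fun w ↦ F (φ w.1, w.2) := by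
    rw [bind_randomMapKernel hF, ← Measure.map_id (μ := μ),
      Measure.map_prod_map _ _ hφ measurable_id, Measure.map_map hF (by fun_prop), Measure.map_id]
    rfl
  refine ⟨?_, ?_⟩
  · rw [hmarginal measurable_fst, synchronousCoupling, Measure.map_map measurable_fst hpair]
    rfl
  · rw [hmarginal measurable_snd, synchronousCoupling, Measure.map_map measurable_snd hpair]
    rfl

variable [IsProbabilityMeasure μ] {k : ℝ}

theorem lintegral_synchronousCoupling_le (hF : Measurable F) (hN : Measurable N) (hk : 0 ≤ k)
    (hp : 0 ≤ p) (h : ∀ z z' ξ, N (F (z, ξ) - F (z', ξ)) ≤ k * N (z - z'))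
    (ρ : Measure (Phase d × Phase d)) [SFinite ρ] :
    ∫⁻ w, ENNReal.ofReal (N (w.1 - w.2)) ^ p ∂synchronousCoupling F μ ρ ≤
      ENNReal.ofReal k ^ p * ∫⁻ w, ENNReal.ofReal (N (w.1 - w.2)) ^ p ∂ρ := by
  rw [synchronousCoupling, lintegral_map (by fun_prop) (by fun_prop),
    ← (measurePreserving_fst (μ := ρ) (ν := μ)).lintegral_comp
      (f := fun w ↦ ENNReal.ofReal (N (w.1 - w.2)) ^ p) (by fun_prop)]
  exact lintegral_ofReal_rpow_le_of_le_mul hk hp fun _ ↦ h _ _ _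

theorem wass_bind_randomMapKernel_le (hF : Measurable F) (hN : Measurable N) (hk : 0 < k)
    (hp : 0 < p) (h : ∀ z z' ξ, N (F (z, ξ) - F (z', ξ)) ≤ k * N (z - z'))
    (ν ν' : Measure (Phase d)) [IsProbabilityMeasure ν] :
    wass N p (ν.bind (randomMapKernel F μ)) (ν'.bind (randomMapKernel F μ)) ≤
      ENNReal.ofReal k * wass N p ν ν' := by
  refine wass_le_mul_of_forall_couplings hk hp ?_
  rintro ρ ⟨rfl, rfl⟩
  have : IsProbabilityMeasure ρ := Measure.isProbabilityMeasure_of_map Prod.fst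
  exact ⟨_, synchronousCoupling_mem_couplings hF ρ,
    lintegral_synchronousCoupling_le hF hN hk.le hp.le h ρ⟩

theorem lawAfter_succ (P : Kernel (Phase d) (Phase d)) (n : ℕ) (ν : Measure (Phase d)) :
    lawAfter P (n + 1) ν = (lawAfter P n ν).bind P :=
  Function.iterate_succ_apply' _ _ _

theorem isProbabilityMeasure_lawAfter_randomMapKernel (hF : Measurable F) (n : ℕ)
    (ν : Measure (Phase d)) [IsProbabilityMeasure ν] :
    IsProbabilityMeasure (lawAfter (randomMapKernel F μ) n ν) := by
  induction n with
  | zero => assumption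
  | succ n _ => exact lawAfter_succ _ n ν ▸ isProbabilityMeasure_bind_randomMapKernel hF _

theorem wass_lawAfter_randomMapKernel_le (hF : Measurable F) (hN : Measurable N) (hk : 0 < k)
    (hp : 0 < p) (h : ∀ z z' ξ, N (F (z, ξ) - F (z', ξ)) ≤ k * N (z - z'))
    (ν ν' : Measure (Phase d)) [IsProbabilityMeasure ν] (n : ℕ) :
    wass N p (lawAfter (randomMapKernel F μ) n ν) (lawAfter (randomMapKernel F μ) n ν') ≤
      ENNReal.ofReal (k ^ n) * wass N p ν ν' := by
  induction n with
  | zero => simp [lawAfter]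
  | succ n ih =>
    have := isProbabilityMeasure_lawAfter_randomMapKernel (μ := μ) hF n ν
    rw [lawAfter_succ, lawAfter_succ, pow_succ', ENNReal.ofReal_mul hk.le, mul_assoc]
    exact (wass_bind_randomMapKernel_le hF hN hk hp h _ _).trans (by gcongr)

end Wasserstein

section BackwardIteration

variable {X Ω : Type*}

/-- The backward iterates `F_{ω 0} ∘ ⋯ ∘ F_{ω (n - 1)}` of the random maps `F_ξ = F (·, ξ)`: the
newest input acts innermost. Under i.i.d. inputs `ω` they have, for each `n`, the same law as the
chain driven by `F` at time `n`, but unlike the chain they converge almost surely. -/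
def backwardIter (F : X × Ω → X) : ℕ → (ℕ → Ω) → X → X
  | 0, _, x => x
  | n + 1, ω, x => F (backwardIter F n (fun k ↦ ω (k + 1)) x, ω 0)

theorem backwardIter_succ' (F : X × Ω → X) (n : ℕ) (ω : ℕ → Ω) (x : X) :
    backwardIter F (n + 1) ω x = backwardIter F n ω (F (x, ω n)) := by
  induction n generalizing ω with
  | zero => rfl
  | succ n ih => rw [backwardIter, ih]; rfl

/-- `n` successive random maps contract distances by the factor `C qⁿ`, uniformly in the inputs.
The constant `C` leaves room for a contraction in an equivalent metric. -/
def ContractsIterates [PseudoMetricSpace X] (F : X × Ω → X) (C q : ℝ) : Prop :=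
  ∀ n ω x y, dist (backwardIter F n ω x) (backwardIter F n ω y) ≤ C * q ^ n * dist x y

namespace ContractsIterates

variable [PseudoMetricSpace X] {F : X × Ω → X} {C q : ℝ}

theorem continuous (h : ContractsIterates F C q) (ξ : Ω) : Continuous fun x ↦ F (x, ξ) :=
  (LipschitzWith.of_dist_le' fun x y ↦ h 1 (fun _ ↦ ξ) x y).continuous

theorem dist_succ_le (h : ContractsIterates F C q) (n : ℕ) (ω : ℕ → Ω) (x : X) :
    dist (backwardIter F n ω x) (backwardIter F (n + 1) ω x) ≤
      C * q ^ n * dist x (F (x, ω n)) := by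
  rw [backwardIter_succ']
  exact h n ω _ _

theorem dist_backwardIter_le (h : ContractsIterates F C q) (n : ℕ) (ω : ℕ → Ω)
    (x : X) : dist x (backwardIter F n ω x) ≤
      ∑ k ∈ Finset.range n, C * q ^ k * dist x (F (x, ω k)) :=
  (dist_le_range_sum_dist (fun k ↦ backwardIter F k ω x) n).trans
    (Finset.sum_le_sum fun k _ ↦ h.dist_succ_le k ω x)

theorem tendsto_of_tendsto (h : ContractsIterates F C q) (hq : q ∈ Set.Ico 0 1)
    {ω : ℕ → Ω} {x z : X} (hz : Tendsto (fun n ↦ backwardIter F n ω x) atTop (𝓝 z)) (y : X) :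
    Tendsto (fun n ↦ backwardIter F n ω y) atTop (𝓝 z) := by
  refine hz.congr_dist (squeeze_zero (fun _ ↦ dist_nonneg) (fun n ↦ h n ω x y) ?_)
  simpa using ((tendsto_pow_atTop_nhds_zero_of_lt_one hq.1 hq.2).const_mul C).mul_const (dist x y)

end ContractsIterates

variable [MeasurableSpace X] [MeasurableSpace Ω] {F : X × Ω → X} {μ : Measure Ω}

theorem measurable_backwardIter (hF : Measurable F) (n : ℕ) :
    Measurable fun w : X × (ℕ → Ω) ↦ backwardIter F n w.2 w.1 := by
  induction n with
  | zero => exact measurable_fst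
  | succ n ih =>
    have hshift : Measurable fun w : X × (ℕ → Ω) ↦ (w.1, fun k ↦ w.2 (k + 1)) := by fun_prop
    exact hF.comp ((ih.comp hshift).prodMk (by fun_prop))

theorem measurePreserving_natCases (μ : Measure Ω) [IsProbabilityMeasure μ] :
    MeasurePreserving (fun (w : (ℕ → Ω) × Ω) n ↦ (Nat.casesOn n w.2 w.1 : Ω))
      ((Measure.infinitePi fun _ ↦ μ).prod μ) (Measure.infinitePi fun _ ↦ μ) := by
  classical
  have hmeas : Measurable fun (w : (ℕ → Ω) × Ω) n ↦ (Nat.casesOn n w.2 w.1 : Ω) :=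
    measurable_pi_lambda _ fun n ↦ by cases n <;> simp only <;> fun_prop
  refine ⟨hmeas, Measure.eq_infinitePi _ fun s t ht ↦ ?_⟩
  have hbox : (fun (w : (ℕ → Ω) × Ω) n ↦ (Nat.casesOn n w.2 w.1 : Ω)) ⁻¹' (s : Set ℕ).pi t =
      ((s.preimage Nat.succ Nat.succ_injective.injOn : Set ℕ).pi fun k ↦ t (k + 1)) ×ˢ
        {a | 0 ∈ s → a ∈ t 0} := by
    ext w
    simp [Set.mem_pi, ← Nat.and_forall_add_one (p := fun n ↦ n ∈ s → _), and_comm]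
  rw [Measure.map_apply hmeas (.pi s.countable_toSet fun i _ ↦ ht i), hbox, Measure.prod_prod,
    Measure.infinitePi_pi _ fun i _ ↦ ht (i + 1),
    Finset.prod_preimage' Nat.succ s Nat.succ_injective.injOn fun i ↦ μ (t i)]
  have hsucc : {i ∈ s | i ∈ Set.range Nat.succ} = s.erase 0 := by
    ext i
    simp [Nat.range_succ, Nat.pos_iff_ne_zero, and_comm]
  rw [hsucc]
  by_cases h0 : 0 ∈ s
  · simpa [h0] using Finset.prod_erase_mul s (fun i ↦ μ (t i)) h0
  · simp [h0]

theorem measurePreserving_tail_head (μ : Measure Ω) [IsProbabilityMeasure μ] :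
    MeasurePreserving (fun ω : ℕ → Ω ↦ ((fun k ↦ ω (k + 1) : ℕ → Ω), ω 0))
      (Measure.infinitePi fun _ ↦ μ) ((Measure.infinitePi fun _ ↦ μ).prod μ) := by
  refine ⟨by fun_prop, ?_⟩
  have hcons := measurePreserving_natCases μ
  conv_lhs => rw [← hcons.map_eq, Measure.map_map (by fun_prop) hcons.measurable]
  exact Measure.map_id

variable [IsProbabilityMeasure μ]

theorem map_prod_infinitePi_step {Y : Type*} [MeasurableSpace Y] (hF : Measurable F)
    {G : Y × (ℕ → Ω) → X} (hG : Measurable G) (ν : Measure Y) [SFinite ν] :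
    (ν.prod (Measure.infinitePi fun _ ↦ μ)).map
        (fun w ↦ F (G (w.1, fun k ↦ w.2 (k + 1)), w.2 0)) =
      ((ν.prod (Measure.infinitePi fun _ ↦ μ)).map G).bind (randomMapKernel F μ) := by
  have hsplit := (measurePreserving_prodAssoc ν (Measure.infinitePi fun _ ↦ μ) μ).symm.comp
    ((MeasurePreserving.id ν).prod (measurePreserving_tail_head μ))
  have hmap := Measure.map_prod_map (ν.prod (Measure.infinitePi fun _ ↦ μ)) μ hG measurable_id
  rw [Measure.map_id] at hmap
  rw [bind_randomMapKernel hF, hmap, ← hsplit.map_eq, Measure.map_map hF (by fun_prop),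
    Measure.map_map (by fun_prop) hsplit.measurable]
  rfl

theorem map_backwardIter_of_invariant (hF : Measurable F) {ν : Measure X} [SFinite ν]
    (hν : (randomMapKernel F μ).Invariant ν) (n : ℕ) :
    (ν.prod (Measure.infinitePi fun _ ↦ μ)).map (fun w ↦ backwardIter F n w.2 w.1) = ν := by
  induction n with
  | zero => exact (measurePreserving_fst (ν := Measure.infinitePi fun _ : ℕ ↦ μ)).map_eq
  | succ n ih =>
    have hstep := map_prod_infinitePi_step (μ := μ) hF (measurable_backwardIter hF n) ν
    rwa [ih, hν] at hstep

end BackwardIteration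

section StationaryLaw

variable {X Ω : Type*} [MetricSpace X] [MeasurableSpace Ω] {F : X × Ω → X} {C q : ℝ}
  {μ : Measure Ω} [IsProbabilityMeasure μ] {Z : (ℕ → Ω) → X} {x : X}

theorem tsum_enorm_mul_pow_ne_top (hq : q ∈ Set.Ico 0 1) : ∑' n : ℕ, ‖C * q ^ n‖ₑ ≠ ⊤ := by
  simp only [enorm_mul, enorm_pow, ENNReal.tsum_mul_left, ENNReal.tsum_geometric]
  refine ENNReal.mul_ne_top enorm_ne_top (ENNReal.inv_ne_top.2 (tsub_pos_of_lt ?_).ne')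
  rw [Real.enorm_of_nonneg hq.1]
  exact ENNReal.ofReal_lt_one.2 hq.2

theorem eLpNorm_const_mul_comp_eval {g : Ω → ℝ} (hg : AEStronglyMeasurable g μ) (c : ℝ) (p : ℝ≥0∞)
    (n : ℕ) : eLpNorm (fun ω : ℕ → Ω ↦ c * g (ω n)) p (Measure.infinitePi fun _ ↦ μ) =
      ‖c‖ₑ * eLpNorm g p μ := by
  rw [← eLpNorm_comp_measurePreserving hg (measurePreserving_eval_infinitePi (fun _ : ℕ ↦ μ) n)]
  exact eLpNorm_const_smul c _ p _

theorem ContractsIterates.ae_cauchySeq (h : ContractsIterates F C q) (hq : q ∈ Set.Ico 0 1)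
    (hx : MemLp (fun ξ ↦ dist x (F (x, ξ))) 1 μ) :
    ∀ᵐ ω ∂Measure.infinitePi fun _ : ℕ ↦ μ, CauchySeq fun n ↦ backwardIter F n ω x := by
  have hmeas (n : ℕ) : AEMeasurable (fun ω : ℕ → Ω ↦ ‖C * q ^ n * dist x (F (x, ω n))‖ₑ)
      (Measure.infinitePi fun _ ↦ μ) :=
    ((hx.1.comp_measurePreserving (measurePreserving_eval_infinitePi (fun _ : ℕ ↦ μ) n)).const_mul
      _).enorm
  have hsum : ∫⁻ ω : ℕ → Ω, ∑' n, ‖C * q ^ n * dist x (F (x, ω n))‖ₑ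
      ∂Measure.infinitePi (fun _ ↦ μ) ≠ ⊤ := by
    rw [lintegral_tsum hmeas]
    simp only [← eLpNorm_one_eq_lintegral_enorm, eLpNorm_const_mul_comp_eval hx.1,
      ENNReal.tsum_mul_right]
    exact ENNReal.mul_ne_top (tsum_enorm_mul_pow_ne_top hq) hx.2.ne
  filter_upwards [ae_lt_top' (AEMeasurable.tsum hmeas) hsum] with ω hω
  refine cauchySeq_of_edist_le_of_tsum_ne_top _ (fun n ↦ ?_) hω.ne
  rw [edist_dist]
  exact (ENNReal.ofReal_le_ofReal (h.dist_succ_le n ω x)).trans (Real.ofReal_le_enorm _)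

theorem ContractsIterates.eLpNorm_dist_backwardIter_le (h : ContractsIterates F C q) {p : ℝ≥0∞}
    (hp : 1 ≤ p) (hx : AEStronglyMeasurable (fun ξ ↦ dist x (F (x, ξ))) μ) (n : ℕ) :
    eLpNorm (fun ω ↦ dist x (backwardIter F n ω x)) p (Measure.infinitePi fun _ ↦ μ) ≤
      (∑' k : ℕ, ‖C * q ^ k‖ₑ) * eLpNorm (fun ξ ↦ dist x (F (x, ξ))) p μ := by
  have hmeas (k : ℕ) := (hx.comp_measurePreserving
    (measurePreserving_eval_infinitePi (fun _ : ℕ ↦ μ) k)).const_mul (C * q ^ k)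
  calc
    _ ≤ eLpNorm (∑ k ∈ Finset.range n, fun ω : ℕ → Ω ↦ C * q ^ k * dist x (F (x, ω k))) p
        (Measure.infinitePi fun _ ↦ μ) := by
      refine eLpNorm_mono_real fun ω ↦ ?_
      rw [Real.norm_of_nonneg dist_nonneg, Finset.sum_apply]
      exact h.dist_backwardIter_le n ω x
    _ ≤ ∑ k ∈ Finset.range n, ‖C * q ^ k‖ₑ * eLpNorm (fun ξ ↦ dist x (F (x, ξ))) p μ :=
      (eLpNorm_sum_le (fun k _ ↦ hmeas k) hp).trans_eq
        (Finset.sum_congr rfl fun k _ ↦ eLpNorm_const_mul_comp_eval hx _ p k)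
    _ ≤ _ := by
      rw [← Finset.sum_mul]
      gcongr
      exact ENNReal.sum_le_tsum _

variable [MeasurableSpace X]

/-- `Z` is the almost sure limit of the backward iterates of `F` along i.i.d. inputs of law `μ`,
whatever the starting point. -/
structure IsBackwardLimit (F : X × Ω → X) (μ : Measure Ω) [IsProbabilityMeasure μ]
    (Z : (ℕ → Ω) → X) : Prop where
  measurable : Measurable Z
  ae_tendsto : ∀ᵐ ω ∂Measure.infinitePi fun _ : ℕ ↦ μ,
    ∀ y, Tendsto (fun n ↦ backwardIter F n ω y) atTop (𝓝 (Z ω))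

theorem IsBackwardLimit.invariant_map (hZ : IsBackwardLimit F μ Z)
    (hF : Measurable F) (hcont : ∀ ξ, Continuous fun x ↦ F (x, ξ)) :
    (randomMapKernel F μ).Invariant ((Measure.infinitePi fun _ : ℕ ↦ μ).map Z) := by
  have hsplit := measurePreserving_tail_head μ
  have hae : (fun ω : ℕ → Ω ↦ F (Z fun k ↦ ω (k + 1), ω 0)) =ᵐ[Measure.infinitePi fun _ ↦ μ] Z := by
    filter_upwards [hZ.ae_tendsto, (measurePreserving_fst.comp hsplit).quasiMeasurePreserving.ae
      hZ.ae_tendsto] with ω hω htail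
    exact tendsto_nhds_unique (((hcont (ω 0)).tendsto _).comp (htail (Z ω)))
      ((hω (Z ω)).comp (tendsto_add_atTop_nat 1))
  have hZtail := hZ.measurable.prodMap measurable_id |>.comp hsplit.measurable
  have hmap := Measure.map_prod_map (Measure.infinitePi fun _ : ℕ ↦ μ) μ hZ.measurable measurable_id
  rw [Measure.map_id, ← hsplit.map_eq,
    Measure.map_map (hZ.measurable.prodMap measurable_id) hsplit.measurable] at hmap
  rw [Kernel.Invariant, bind_randomMapKernel hF, hmap, Measure.map_map hF hZtail]
  exact Measure.map_congr hae

variable [BorelSpace X]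

theorem ContractsIterates.exists_isBackwardLimit [CompleteSpace X] (h : ContractsIterates F C q)
    (hq : q ∈ Set.Ico 0 1) (hF : Measurable F) (hx : MemLp (fun ξ ↦ dist x (F (x, ξ))) 1 μ) :
    ∃ Z, IsBackwardLimit F μ Z := by
  obtain ⟨Z, hZ, hlim⟩ := measurable_limit_of_tendsto_metrizable_ae
    (μ := Measure.infinitePi fun _ : ℕ ↦ μ) (f := fun n ω ↦ backwardIter F n ω x)
    (fun n ↦ ((measurable_backwardIter hF n).comp measurable_prodMk_left).aemeasurable)
    ((h.ae_cauchySeq hq hx).mono fun ω ↦ cauchySeq_tendsto_of_complete)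
  exact ⟨Z, hZ, hlim.mono fun ω hω ↦ h.tendsto_of_tendsto hq hω⟩

theorem IsBackwardLimit.eq_map_of_invariant (hZ : IsBackwardLimit F μ Z) (hF : Measurable F)
    {ν : Measure X} [IsProbabilityMeasure ν] (hν : (randomMapKernel F μ).Invariant ν) :
    ν = (Measure.infinitePi fun _ : ℕ ↦ μ).map Z := by
  let P := ν.prod (Measure.infinitePi fun _ : ℕ ↦ μ)
  have hsnd : MeasurePreserving Prod.snd P (Measure.infinitePi fun _ ↦ μ) := measurePreserving_snd
  have hlim : TendstoInDistribution (fun n w ↦ backwardIter F n w.2 w.1) atTop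
      (fun w ↦ Z w.2) (fun _ ↦ P) P :=
    tendstoInDistribution_of_ae_tendsto
      (fun n ↦ (measurable_backwardIter hF n).aemeasurable)
      (hZ.measurable.comp measurable_snd).aemeasurable
      ((hsnd.quasiMeasurePreserving.ae hZ.ae_tendsto).mono fun w hw ↦ hw w.1)
  have hident (n : ℕ) : IdentDistrib (fun w ↦ backwardIter F n w.2 w.1) id P ν :=
    ⟨(measurable_backwardIter hF n).aemeasurable, aemeasurable_id,
      (map_backwardIter_of_invariant hF hν n).trans Measure.map_id.symm⟩
  have hconst := tendstoInDistribution_of_identDistrib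
    (X := fun n w ↦ backwardIter F n w.2 w.1) (μ := fun _ ↦ P) (l := atTop) 0
    (fun n ↦ (hident 0).trans (hident n).symm) (hident 0)
  rw [← hsnd.map_eq, Measure.map_map hZ.measurable measurable_snd, ← Measure.map_id (μ := ν)]
  exact tendstoInDistribution_unique _ hconst hlim

theorem IsBackwardLimit.memLp_dist (hZ : IsBackwardLimit F μ Z) (h : ContractsIterates F C q)
    (hq : q ∈ Set.Ico 0 1) (hF : Measurable F) {p : ℝ≥0∞} (hp : 1 ≤ p)
    (hx : MemLp (fun ξ ↦ dist x (F (x, ξ))) p μ) :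
    MemLp (dist x) p ((Measure.infinitePi fun _ : ℕ ↦ μ).map Z) := by
  have hdist : Continuous (dist x) := by fun_prop
  have hiter (n : ℕ) : Measurable fun ω ↦ dist x (backwardIter F n ω x) :=
    hdist.measurable.comp ((measurable_backwardIter hF n).comp measurable_prodMk_left)
  refine (memLp_map_measure_iff hdist.aestronglyMeasurable hZ.measurable.aemeasurable).2
    ⟨(hdist.measurable.comp hZ.measurable).aestronglyMeasurable, ?_⟩
  have hfatou := Lp.eLpNorm_lim_le_liminf_eLpNorm (p := p)
    (fun n ↦ (hiter n).aestronglyMeasurable) (dist x ∘ Z)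
    (hZ.ae_tendsto.mono fun ω hω ↦ (hdist.tendsto _).comp (hω x))
  refine (hfatou.trans (liminf_le_of_frequently_le' (.of_forall fun n ↦
    h.eLpNorm_dist_backwardIter_le hp hx.1 n))).trans_lt ?_
  exact ENNReal.mul_lt_top (tsum_enorm_mul_pow_ne_top hq).lt_top hx.2

theorem ContractsIterates.exists_unique_invariant [CompleteSpace X] (h : ContractsIterates F C q)
    (hq : q ∈ Set.Ico 0 1) (hF : Measurable F)
    (hx : ∀ p : ℝ≥0∞, 1 ≤ p → p ≠ ⊤ → MemLp (fun ξ ↦ dist x (F (x, ξ))) p μ) :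
    ∃ σ : Measure X, IsProbabilityMeasure σ ∧ (randomMapKernel F μ).Invariant σ ∧
      (∀ ν : Measure X, IsProbabilityMeasure ν → (randomMapKernel F μ).Invariant ν → ν = σ) ∧
      ∀ p : ℝ≥0∞, 1 ≤ p → p ≠ ⊤ → MemLp (dist x) p σ := by
  obtain ⟨Z, hZ⟩ := h.exists_isBackwardLimit hq hF (hx 1 le_rfl ENNReal.one_ne_top)
  exact ⟨_, Measure.isProbabilityMeasure_map hZ.measurable.aemeasurable,
    hZ.invariant_map hF h.continuous, fun ν _ hν ↦ hZ.eq_map_of_invariant hF hν,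
    fun p hp hp' ↦ hZ.memLp_dist h hq hF hp (hx p hp hp')⟩

end StationaryLaw

section Conclusion

theorem contractsIterates_of_contraction {X Ω : Type*} [SeminormedAddCommGroup X] {F : X × Ω → X}
    {N : X → ℝ} {A B q : ℝ} (hA : 0 ≤ A) (hq : 0 ≤ q) (hlow : ∀ z, ‖z‖ ≤ A * N z)
    (hup : ∀ z, N z ≤ B * ‖z‖) (h : ∀ z z' ξ, N (F (z, ξ) - F (z', ξ)) ≤ q * N (z - z')) :
    ContractsIterates F (A * B) q := by
  intro n ω z z'
  have hiter (n : ℕ) : ∀ ω : ℕ → Ω,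
      N (backwardIter F n ω z - backwardIter F n ω z') ≤ q ^ n * N (z - z') := by
    induction n with
    | zero => simp [backwardIter]
    | succ n ih =>
      intro ω
      rw [pow_succ', mul_assoc]
      exact (h _ _ _).trans (by gcongr; exact ih _)
  rw [dist_eq_norm, dist_eq_norm]
  calc _ ≤ A * N (backwardIter F n ω z - backwardIter F n ω z') := hlow _
    _ ≤ A * (q ^ n * (B * ‖z - z'‖)) := by
      gcongr
      exact (hiter n ω).trans (by gcongr; exact hup _)
    _ = A * B * q ^ n * ‖z - z'‖ := by ring

theorem memLp_comp_of_lipschitzWith {α V W : Type*} [MeasurableSpace α] [NormedAddCommGroup V]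
    [NormedAddCommGroup W] {μ : Measure α} [IsFiniteMeasure μ] {p : ℝ≥0∞} {K : ℝ≥0} {f : V → W}
    {X : α → V} (hf : LipschitzWith K f) (hX : MemLp X p μ) : MemLp (fun a ↦ f (X a)) p μ := by
  have hsub : LipschitzWith (K + 0) fun x ↦ f x - f 0 := hf.sub (.const _)
  refine ((hsub.comp_memLp (sub_self _) hX).add (memLp_const (f 0))).ae_eq (.of_forall fun a ↦ ?_)
  simp

theorem le_sqrt_mul_of_sq_le {x y k : ℝ} (hk : 0 ≤ k) (hy : 0 ≤ y) (h : x ^ 2 ≤ k * y ^ 2) :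
    x ≤ √k * y :=
  (Real.le_sqrt_of_sq_le h).trans_eq (by rw [Real.sqrt_mul hk, Real.sqrt_sq hy])

variable {d : ℕ} {f : E d → E d} {N N' : Phase d → ℝ} {m M lam γ p : ℝ} {K : ℝ≥0}

theorem ofReal_sqrt_mul_sq {k : ℝ} (hk : 0 ≤ k) (x : ℝ≥0∞) :
    (ENNReal.ofReal √k * x) ^ 2 = ENNReal.ofReal k * x ^ 2 := by
  rw [mul_pow, ← ENNReal.ofReal_pow (Real.sqrt_nonneg _), Real.sq_sqrt hk]

theorem wass_sq_le_of_norm_sq_le {k : ℝ} (hk : 0 < k) (hp : 0 < p) (hN : ∀ z, 0 ≤ N z)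
    (h : ∀ z, N' z ^ 2 ≤ k * N z ^ 2) (μ ν : Measure (Phase d)) :
    wass N' p μ ν ^ 2 ≤ ENNReal.ofReal k * wass N p μ ν ^ 2 := by
  rw [← ofReal_sqrt_mul_sq hk.le]
  gcongr
  exact wass_le_of_norm_le (Real.sqrt_pos.2 hk) hp
    (fun z ↦ le_sqrt_mul_of_sq_le hk.le (hN z) (h z)) μ ν

theorem inPp_of_memLp {σ : Measure (Phase d)} [IsProbabilityMeasure σ] (hp : 0 < p)
    (h : MemLp (dist (0 : Phase d)) (ENNReal.ofReal p) σ) : InPp p σ := by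
  have hnorm := lintegral_rpow_enorm_lt_top_of_eLpNorm_lt_top
    (ENNReal.ofReal_pos.2 hp).ne' ENNReal.ofReal_ne_top h.2
  rw [ENNReal.toReal_ofReal hp.le] at hnorm
  refine ⟨inferInstance, (lintegral_ofReal_rpow_le_of_le_mul (g := dist 0) (Real.sqrt_nonneg 2)
    hp.le fun z ↦ ?_).trans_lt (ENNReal.mul_lt_top (by finiteness) ?_)⟩
  · exact le_sqrt_mul_of_sq_le zero_le_two dist_nonneg
      (by rw [dist_zero_left]; exact euclNorm_sq_le_two_mul_norm_sq z)
  · simpa only [Real.enorm_of_nonneg dist_nonneg] using hnorm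

theorem memLp_obaboStep {μ : Measure (E d × E d)} [IsFiniteMeasure μ] {q : ℝ≥0∞}
    (hf : LipschitzWith K f) (hμ : MemLp id q μ) (lam γ : ℝ) (z : Phase d) :
    MemLp (fun G ↦ obaboStep f lam γ (z, G)) q μ := by
  have hG : MemLp (fun G : E d × E d ↦ G.1) q μ := hμ.fst
  have hG' : MemLp (fun G : E d × E d ↦ G.2) q μ := hμ.snd
  have hx : MemLp (fun G : E d × E d ↦ obaboPos f lam γ z.1 z.2 G.1) q μ :=
    (((memLp_const z.1).add (((memLp_const (eta lam γ • z.2)).add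
      (hG.const_smul √(1 - eta lam γ ^ 2))).const_smul lam)).sub
      (memLp_const ((lam ^ 2 / 2) • f z.1))).ae_eq (.of_forall fun _ ↦ rfl)
  have hfx : MemLp (fun G : E d × E d ↦ f (obaboPos f lam γ z.1 z.2 G.1)) q μ :=
    memLp_comp_of_lipschitzWith hf hx
  have hv : MemLp (fun G : E d × E d ↦ (obaboStep f lam γ (z, G)).2) q μ :=
    (((memLp_const (eta lam γ ^ 2 • z.2)).sub
      (((memLp_const (f z.1)).add hfx).const_smul (lam * eta lam γ / 2))).add
      (((hG.const_smul (eta lam γ)).add hG').const_smul √(1 - eta lam γ ^ 2))).ae_eq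
      (.of_forall fun _ ↦ rfl)
  exact memLp_prod_iff.2 ⟨hx, hv⟩

theorem weightedNorm_obaboStep_sub_le (hm : 0 < m) (hmM : m ≤ M) (hlam : 0 < lam) (hγ : 0 < γ)
    (hγM : 2 * √M ≤ γ) (hlamγ : lam ≤ m / (33 * γ ^ 3))
    (hf : CocoerciveOn (3 * (M - m)) (fun x ↦ f x - m • x) Set.univ)
    (z z' : Phase d) (G : E d × E d) :
    weightedNorm (1 / M) (1 / γ) (obaboStep f lam γ (z, G) - obaboStep f lam γ (z', G)) ≤
      √(1 - lam * (m / (3 * γ))) * weightedNorm (1 / M) (1 / γ) (z - z') :=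
  le_sqrt_mul_of_sq_le (one_sub_mul_mem_Ioo hm hmM hlam hγ hγM hlamγ).1.le (Real.sqrt_nonneg _)
    (weightedNorm_obaboStep_sub_sq_le hm hmM hlam hγ hγM hlamγ hf z z' G)

theorem wass_weightedNorm_lawAfter_sq_le (hm : 0 < m) (hmM : m ≤ M) (hlam : 0 < lam) (hγ : 0 < γ)
    (hγM : 2 * √M ≤ γ) (hlamγ : lam ≤ m / (33 * γ ^ 3))
    (hf : CocoerciveOn (3 * (M - m)) (fun x ↦ f x - m • x) Set.univ) (hp : 0 < p)
    (ν μ : Measure (Phase d)) [IsProbabilityMeasure ν] (n : ℕ) :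
    wass (weightedNorm (1 / M) (1 / γ)) p (lawAfter (obaboKernel f lam γ) n ν)
        (lawAfter (obaboKernel f lam γ) n μ) ^ 2 ≤
      ENNReal.ofReal ((1 - lam * (m / (3 * γ))) ^ n) *
        wass (weightedNorm (1 / M) (1 / γ)) p ν μ ^ 2 := by
  have hrate := one_sub_mul_mem_Ioo hm hmM hlam hγ hγM hlamγ
  obtain ⟨K, hK⟩ := hf.exists_lipschitzWith (by linarith)
  rw [← ofReal_sqrt_mul_sq (pow_nonneg hrate.1.le n), Real.sqrt_eq_rpow, ← Real.rpow_pow_comm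
    hrate.1.le, ← Real.sqrt_eq_rpow]
  gcongr
  exact wass_lawAfter_randomMapKernel_le
    (measurable_obaboStep hK.continuous.measurable lam γ) (continuous_weightedNorm _ _).measurable
    (Real.sqrt_pos.2 hrate.1) hp (weightedNorm_obaboStep_sub_le hm hmM hlam hγ hγM hlamγ hf) ν μ n

theorem wass_euclNorm_lawAfter_sq_le (hm : 0 < m) (hmM : m ≤ M) (hM : 1 ≤ M) (hlam : 0 < lam)
    (hγ : 0 < γ) (hγM : 2 * √M ≤ γ) (hlamγ : lam ≤ m / (33 * γ ^ 3))
    (hf : CocoerciveOn (3 * (M - m)) (fun x ↦ f x - m • x) Set.univ) (hp : 0 < p)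
    (ν μ : Measure (Phase d)) [IsProbabilityMeasure ν] (n : ℕ) :
    wass euclNorm p (lawAfter (obaboKernel f lam γ) n ν)
        (lawAfter (obaboKernel f lam γ) n μ) ^ 2 ≤
      ENNReal.ofReal (3 * M * (1 - lam * (m / (3 * γ))) ^ n) * wass euclNorm p ν μ ^ 2 := by
  have hM0 : 0 < M := hm.trans_le hmM
  have hab := four_mul_one_div_sq_le hM0 hγ hγM
  have ha : 1 / M ≤ 1 := div_le_one_of_le₀ hM hM0.le
  have hrate := one_sub_mul_mem_Ioo hm hmM hlam hγ hγM hlamγ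
  have hlow (z : Phase d) : euclNorm z ^ 2 ≤ 2 * M * weightedNorm (1 / M) (1 / γ) z ^ 2 := by
    have hle := min_mul_euclNorm_sq_le hab z
    rw [min_eq_right ha, one_div_mul_eq_div, div_le_iff₀ hM0] at hle
    linarith
  have hup (z : Phase d) : weightedNorm (1 / M) (1 / γ) z ^ 2 ≤ 3 / 2 * euclNorm z ^ 2 := by
    simpa only [max_eq_left ha, mul_one] using weightedNorm_sq_le_euclNorm_sq hab z
  calc _ ≤ ENNReal.ofReal (2 * M) * (ENNReal.ofReal ((1 - lam * (m / (3 * γ))) ^ n) *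
          (ENNReal.ofReal (3 / 2) * wass euclNorm p ν μ ^ 2)) := by
        refine (wass_sq_le_of_norm_sq_le (by positivity) hp (fun _ ↦ Real.sqrt_nonneg _) hlow
          _ _).trans ?_
        gcongr
        refine (wass_weightedNorm_lawAfter_sq_le hm hmM hlam hγ hγM hlamγ hf hp ν μ n).trans ?_
        gcongr
        exact wass_sq_le_of_norm_sq_le (by norm_num) hp (fun _ ↦ Real.sqrt_nonneg _) hup ν μ
    _ = _ := by
      rw [← mul_assoc, ← mul_assoc, ← ENNReal.ofReal_mul (by positivity),
        ← ENNReal.ofReal_mul (mul_nonneg (by positivity) (pow_nonneg hrate.1.le n))]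
      congr 2
      ring

theorem exists_contractsIterates_obaboStep (hm : 0 < m) (hmM : m ≤ M) (hlam : 0 < lam)
    (hγ : 0 < γ) (hγM : 2 * √M ≤ γ) (hlamγ : lam ≤ m / (33 * γ ^ 3))
    (hf : CocoerciveOn (3 * (M - m)) (fun x ↦ f x - m • x) Set.univ) :
    ∃ C, ContractsIterates (obaboStep f lam γ) C √(1 - lam * (m / (3 * γ))) := by
  have hM : 0 < M := hm.trans_le hmM
  have hab := four_mul_one_div_sq_le hM hγ hγM
  have hmin : 0 < min 1 (1 / M) := lt_min one_pos (one_div_pos.2 hM)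
  have hlow (z : Phase d) :
      ‖z‖ ≤ √(2 / min 1 (1 / M)) * weightedNorm (1 / M) (1 / γ) z := by
    refine (norm_le_euclNorm z).trans
      (le_sqrt_mul_of_sq_le (by positivity) (Real.sqrt_nonneg _) ?_)
    rw [div_mul_eq_mul_div, le_div_iff₀' hmin]
    exact min_mul_euclNorm_sq_le hab z
  have hup (z : Phase d) :
      weightedNorm (1 / M) (1 / γ) z ≤ √(3 / 2 * max 1 (1 / M) * 2) * ‖z‖ := by
    refine le_sqrt_mul_of_sq_le (by positivity) (norm_nonneg _) ?_
    rw [mul_assoc _ 2]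
    exact (weightedNorm_sq_le_euclNorm_sq hab z).trans
      (by gcongr; exact euclNorm_sq_le_two_mul_norm_sq z)
  exact ⟨_, contractsIterates_of_contraction (Real.sqrt_nonneg _) (Real.sqrt_nonneg _) hlow hup
    (weightedNorm_obaboStep_sub_le hm hmM hlam hγ hγM hlamγ hf)⟩

theorem exists_unique_invariant_obaboKernel (hm : 0 < m) (hmM : m ≤ M) (hlam : 0 < lam)
    (hγ : 0 < γ) (hγM : 2 * √M ≤ γ) (hlamγ : lam ≤ m / (33 * γ ^ 3))
    (hf : CocoerciveOn (3 * (M - m)) (fun x ↦ f x - m • x) Set.univ) :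
    ∃ σ : Measure (Phase d), IsProbabilityMeasure σ ∧ (obaboKernel f lam γ).Invariant σ ∧
      (∀ p : ℝ, 1 ≤ p → InPp p σ) ∧
      ∀ σ' : Measure (Phase d), IsProbabilityMeasure σ' → (obaboKernel f lam γ).Invariant σ' →
        σ' = σ := by
  obtain ⟨K, hK⟩ := hf.exists_lipschitzWith (by linarith)
  obtain ⟨C, hC⟩ := exists_contractsIterates_obaboStep hm hmM hlam hγ hγM hlamγ hf
  have hrate := one_sub_mul_mem_Ioo hm hmM hlam hγ hγM hlamγ
  have hdispl (p : ℝ≥0∞) (hp : p ≠ ⊤) : MemLp (fun G ↦ dist 0 (obaboStep f lam γ (0, G))) p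
      ((stdGaussian (E d)).prod (stdGaussian (E d))) := by
    simpa only [dist_zero_left] using (memLp_obaboStep hK (IsGaussian.memLp_id _ p hp) lam γ 0).norm
  obtain ⟨σ, hσ, hinv, huniq, hmom⟩ := hC.exists_unique_invariant
    ⟨Real.sqrt_nonneg _, (Real.sqrt_lt' one_pos).2 (hrate.2.trans_eq (one_pow 2).symm)⟩
    (measurable_obaboStep hK.continuous.measurable lam γ) fun p _ hp ↦ hdispl p hp
  exact ⟨σ, hσ, hinv, fun p hp ↦ inPp_of_memLp (one_pos.trans_le hp)
    (hmom _ (ENNReal.one_le_ofReal.2 hp) ENNReal.ofReal_ne_top), huniq⟩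

theorem PolyLipschitz.lipschitzOnWith_ball {L l r : ℝ} {h : E d → E d} (hlip : PolyLipschitz h L l)
    (hL : 0 ≤ L) (hl : 0 ≤ l) :
    LipschitzOnWith (L * (1 + r + r) ^ l).toNNReal h (Metric.ball 0 r) :=
  .of_dist_le' fun x hx y hy ↦ by
    rw [mem_ball_zero_iff] at hx hy
    rw [dist_eq_norm, dist_eq_norm]
    exact (hlip x y).trans (by gcongr)

theorem tamingRadius_pos {L l : ℝ} (hL : 0 < L) (hm : 0 < m) (hlam : 0 < lam) :
    0 < tamingRadius m L l lam := by
  unfold tamingRadius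
  positivity

theorem StrongMonotone.mono {h : E d → E d} {m' : ℝ} (hh : StrongMonotone h m) (hm : m' ≤ m) :
    StrongMonotone h m' := fun x y ↦
  (mul_le_mul_of_nonneg_right (by linarith) (sq_nonneg _)).trans (hh x y)

end Conclusion

end TamedOBABO

theorem mainTheorem8_general {d : ℕ} (hd : 0 < d) {u : E d → ℝ} (hu : Differentiable ℝ u)
    {m r M lam γ : ℝ} {K : ℝ≥0} (hm : 0 < m) (hr : 0 < r)
    (hconv : StrongMonotone (gradient u) (m / 2))
    (hlip : LipschitzOnWith K (gradient u) (Metric.ball 0 r)) (hlam : 0 < lam)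
    (hM : OneSidedLipschitzOn M (tamedDriftAt (gradient u) m r) Set.univ)
    (hγM : 2 * √M ≤ γ) (hlamγ : lam ≤ m / (33 * γ ^ 3)) :
    let P : Kernel (Phase d) (Phase d) := obaboKernel (tamedDriftAt (gradient u) m r) lam γ
    let a : ℝ := 1 / M
    let b : ℝ := 1 / γ
    let κ : ℝ := m / (3 * γ)
    (∀ p : ℝ, 1 ≤ p → ∀ ν μ : Measure (Phase d), IsProbabilityMeasure ν →
      wass (weightedNorm a b) p (ν.bind P) (μ.bind P) ^ 2 ≤
          ENNReal.ofReal (1 - lam * κ) * wass (weightedNorm a b) p ν μ ^ 2 ∧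
      (1 ≤ M → ∀ n : ℕ,
        wass euclNorm p (lawAfter P n ν) (lawAfter P n μ) ^ 2 ≤
          ENNReal.ofReal (3 * M * (1 - lam * κ) ^ n) * wass euclNorm p ν μ ^ 2)) ∧
    (∃ σ : Measure (Phase d), IsProbabilityMeasure σ ∧ P.Invariant σ ∧
      (∀ p : ℝ, 1 ≤ p → InPp p σ) ∧
      ∀ σ' : Measure (Phase d), IsProbabilityMeasure σ' → P.Invariant σ' → σ' = σ) := by
  have hmM : m ≤ M := sub_nonneg.1 (tamingSup_nonneg.trans (tamingSup_le hd hr hM))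
  have hγ : 0 < γ := hγM.trans_lt' (by have := hm.trans_le hmM; positivity)
  have hf := cocoerciveOn_tamedDriftAt_sub_smul hu hd hr hconv (lipschitzOnWith_gDrift hlip m) hM
  refine ⟨fun p hp ν μ _ ↦ ?_, exists_unique_invariant_obaboKernel hm hmM hlam hγ hγM hlamγ hf⟩
  have hp0 : 0 < p := one_pos.trans_le hp
  refine ⟨?_, fun hM1 ↦ wass_euclNorm_lawAfter_sq_le hm hmM hM1 hlam hγ hγM hlamγ hf hp0 ν μ⟩
  have hone := wass_weightedNorm_lawAfter_sq_le hm hmM hlam hγ hγM hlamγ hf hp0 ν μ 1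
  rwa [pow_one] at hone

theorem mainTheorem8 (d : ℕ) (hd : 0 < d)
    (u : E d → ℝ) (hu : Differentiable ℝ u)
    (m L l : ℝ) (hm : 0 < m) (hL : 0 < L) (hl : 0 < l)
    (hconv : StrongMonotone (gradient u) m)
    (hlip : PolyLipschitz (gradient u) L l)
    (lam γ M : ℝ) (hlam : 0 < lam) (hγ : 0 < γ)
    -- `M` is the Lipschitz constant of the tamed drift, or any upper bound of it
    (hM : (lipConst (tamedDrift (gradient u) m L l lam) : ℝ) ≤ M)
    (hγM : 2 * √M ≤ γ) (hlamγ : lam ≤ m / (33 * γ ^ 3)) :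
    let P : Kernel (Phase d) (Phase d) :=
      obaboKernel (tamedDrift (gradient u) m L l lam) lam γ
    let a : ℝ := 1 / M
    let b : ℝ := 1 / γ
    let κ : ℝ := m / (3 * γ)
    (∀ p : ℝ, 1 ≤ p → ∀ ν μ : Measure (Phase d), InPp p ν → InPp p μ →
      wass (weightedNorm a b) p (ν.bind P) (μ.bind P) ^ 2 ≤
          ENNReal.ofReal (1 - lam * κ) * wass (weightedNorm a b) p ν μ ^ 2 ∧
      (1 ≤ M → ∀ n : ℕ,
        wass euclNorm p (lawAfter P n ν) (lawAfter P n μ) ^ 2 ≤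
          ENNReal.ofReal (3 * M * (1 - lam * κ) ^ n) * wass euclNorm p ν μ ^ 2)) ∧
    (∃ σ : Measure (Phase d), IsProbabilityMeasure σ ∧ P.Invariant σ ∧
      (∀ p : ℝ, 1 ≤ p → InPp p σ) ∧
      ∀ σ' : Measure (Phase d), IsProbabilityMeasure σ' → P.Invariant σ' → σ' = σ) := by
  have hlip' := hlip.lipschitzOnWith_ball (r := tamingRadius m L l lam) hL.le hl.le
  have hr : 0 < tamingRadius m L l lam := tamingRadius_pos hL hm hlam
  obtain ⟨C, hC⟩ := exists_lipschitzWith_tamedDriftAt hr (lipschitzOnWith_gDrift hlip' m)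
  have hgen := mainTheorem8_general hd hu hm hr (hconv.mono (by linarith)) hlip' hlam
    (oneSidedLipschitzOn_of_lipConst_le hC hM Set.univ) hγM hlamγ
  exact ⟨fun p hp ν μ hν _ ↦ hgen.1 p hp ν μ hν.1, hgen.2⟩
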